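/- Let $V=\{1,\dots,d\}$ and let $F:2^V\to\mathbb{R}$ be nondecreasing and submodular with $F(\varnothing)=0$ and $F(\{k\})>0$ for all $k\in V$. Let $p\in(1,\infty]$ and $\frac1p+\frac1q=1$. For a set-function $G$ on the subsets of a finite set $U$ that is positive on nonempty sets, let $$(\Omega_p^{G})^*(s)=\max_{\varnothing\ne A\subseteq U}\frac{\|s_A\|_q}{G(A)^{1/q}}\qquad(s\in\mathbb{R}^U)$$ (equal to $0$ if $U=\varnothing$), and let $\Omega_p^{G}$ be the norm with this dual norm, i.e. $\Omega_p^{G}(w)=\max\{w^\top s:(\Omega_p^{G})^*(s)\le 1\}$. Write $\Omega=\Omega_p^F$; for $J\subseteq V$, write $\Omega_J=\Omega_p^{F_J}$ on $\mathbb{R}^J$ with $F_J(A)=F(A\cap J)$, and $\Omega^J=\Omega_p^{F^J}$ on $\mathbb{R}^{J^c}$ with $F^J(A)=F(A\cup J)-F(J)$. A set $A\subseteq V$ is stable if $F(B)>F(A)$ for every $B\supsetneq A$. Put $$\rho=\min_{A\subseteq B,\ F(B)>F(A)}\frac{F(B)-F(A)}{F(B\setminus A)}.$$ Let $X\in\mathbb{R}^{n\times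 d}$ be fixed, $Q=\frac1nX^\top X$, and $y=Xw^*+\sigma\varepsilon$, where $w^*\in\mathbb{R}^d$, $w^*\neq0$, $\sigma>0$, and $\varepsilon$ is a standard normal vector in $\mathbb{R}^n$. Let $J$ be the smallest stable set containing $\mathrm{Supp}(w^*)$, let $\nu=\min_{j:\,w^*_j\ne0}|w^*_j|$, and assume $\kappa=\lambda_{\min}(Q_{JJ})>0$. Let $\eta>0$ be such that $$(\Omega^J)^*\Big(\big(\Omega_J(Q_{JJ}^{-1}Q_{Jj})\big)_{j\in J^c}\Big)\le 1-\eta,$$ and let $$0<\lambda\le\frac{\kappa\nu}{2|J|^{1/p}F(J)^{1-1/p}}.$$ Then, with probability at least $$1-3\,\mathbb{P}\Big(\Omega^*(z)>\frac{\lambda\eta\rho\sqrt n}{2\sigma}\Big),$$ where $z$ is a centered normal vector with covariance matrix $Q$, the problem $$\min_{w\in\mathbb{R}^d}\ \frac1{2n}\|y-Xw\|_2^2+\lambda\,\Omega(w)$$ has a unique minimizer $\hat w$, and $\mathrm{Supp}(\hat w)=J$. -/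

import Mathlib

open MeasureTheory ProbabilityTheory
open scoped ENNReal Matrix

namespace SubmodularNorm

/-- A nondecreasing submodular set-function with `F ∅ = 0` that is positive on singletons. -/
structure IsPolymatroid {ι : Type*} [DecidableEq ι] (F : Finset ι → ℝ) : Prop where
  empty : F ∅ = 0
  mono : ∀ A B : Finset ι, A ⊆ B → F A ≤ F B
  submodular : ∀ A B : Finset ι, F (A ∪ B) + F (A ∩ B) ≤ F A + F B
  singleton_pos : ∀ k : ι, 0 < F {k}

/-- `A` is stable if it cannot be augmented without increasing `F`. -/
def IsStable {ι : Type*} (F : Finset ι → ℝ) (A : Finset ι) : Prop :=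
  ∀ B : Finset ι, A ⊆ B → B ≠ A → F A < F B

/-- `Supp(w)`, the set of indices of the nonzero entries of `w`. -/
noncomputable def supp {ι : Type*} [Fintype ι] (w : ι → ℝ) : Finset ι :=
  Finset.univ.filter (fun i => w i ≠ 0)

/-- The restriction `F_J : A ↦ F (A ∩ J)`, as a set-function on the ground set `J`. -/
def restriction {ι : Type*} (F : Finset ι → ℝ) (J : Finset ι) : Finset {j // j ∈ J} → ℝ :=
  fun A => F (A.map (Function.Embedding.subtype (fun j => j ∈ J)))

/-- The contraction `F^J : A ↦ F (A ∪ J) - F J`, as a set-function on the complement of `J`. -/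
def contraction {ι : Type*} [DecidableEq ι] (F : Finset ι → ℝ) (J : Finset ι) :
    Finset {j // j ∉ J} → ℝ :=
  fun A => F (A.map (Function.Embedding.subtype (fun j => j ∉ J)) ∪ J) - F J

/-- The exponent `q` with `1/p + 1/q = 1`, as a real number (finite for `1 < p ≤ ∞`). -/
noncomputable def conjExp (p : ℝ≥0∞) : ℝ := (ENNReal.conjExponent p).toReal

/-- The dual norm `Ω_p^*(s) = max_{A ≠ ∅} ‖s_A‖_q / F(A)^{1/q}`
(it is `0` when the ground set is empty). -/
noncomputable def dualNorm {ι : Type*} (F : Finset ι → ℝ) (p : ℝ≥0∞) (s : ι → ℝ) : ℝ :=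
  ⨆ A : {A : Finset ι // A.Nonempty},
    (∑ i ∈ A.1, |s i| ^ conjExp p) ^ (1 / conjExp p) / F A.1 ^ (1 / conjExp p)

/-- The norm `Ω_p` whose dual norm is `Ω_p^*`. -/
noncomputable def primalNorm {ι : Type*} [Fintype ι] (F : Finset ι → ℝ) (p : ℝ≥0∞)
    (w : ι → ℝ) : ℝ :=
  ⨆ s : {s : ι → ℝ // dualNorm F p s ≤ 1}, w ⬝ᵥ s.1

/-- `ρ = min_{A ⊆ B, F(B) > F(A)} (F(B) - F(A)) / F(B \ A)`. -/
noncomputable def rho {ι : Type*} [DecidableEq ι] (F : Finset ι → ℝ) : ℝ :=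
  ⨅ P : {P : Finset ι × Finset ι // P.1 ⊆ P.2 ∧ F P.1 < F P.2},
    (F P.1.2 - F P.1.1) / F (P.1.2 \ P.1.1)

/-- `ν = min_{j : w_j ≠ 0} |w_j|`, for `w ≠ 0`. -/
noncomputable def minAbs {ι : Type*} (w : ι → ℝ) : ℝ :=
  ⨅ j : {j // w j ≠ 0}, |w j.1|

/-- The smallest eigenvalue of a (nonempty) real symmetric matrix. -/
noncomputable def minEigenvalue {ι : Type*} [Fintype ι] [DecidableEq ι]
    (A : Matrix ι ι ℝ) : ℝ :=
  sInf (spectrum ℝ A)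

/-- `Q = (1/n) Xᵀ X`. -/
noncomputable def gram {n d : ℕ} (X : Matrix (Fin n) (Fin d) ℝ) : Matrix (Fin d) (Fin d) ℝ :=
  (1 / (n : ℝ)) • (Xᵀ * X)

/-- The block `A_JJ` of a square matrix. -/
def block {ι : Type*} (A : Matrix ι ι ℝ) (J : Finset ι) :
    Matrix {j // j ∈ J} {j // j ∈ J} ℝ :=
  A.submatrix Subtype.val Subtype.val

/-- The column `A_Jj` of a square matrix, restricted to the rows in `J`. -/
def colBlock {ι : Type*} (A : Matrix ι ι ℝ) (J : Finset ι) (j : ι) : {j // j ∈ J} → ℝ :=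
  fun i => A i.1 j

/-- The cost `(1/(2n)) ‖y - X w‖₂² + lam Ω_p(w)`. -/
noncomputable def cost {n d : ℕ} (F : Finset (Fin d) → ℝ) (p : ℝ≥0∞)
    (X : Matrix (Fin n) (Fin d) ℝ) (y : Fin n → ℝ) (lam : ℝ) (w : Fin d → ℝ) : ℝ :=
  1 / (2 * (n : ℝ)) * ∑ i, (y i - (X *ᵥ w) i) ^ 2 + lam * primalNorm F p w

end SubmodularNorm

open SubmodularNorm

namespace SubmodularNorm

/-! ### The conjugate exponent -/

/-! The argument is a primal-dual witness construction, followed by a genericity argument for the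
noise. Since $X$ is injective on vectors supported in $J$, the problem restricted to $J$ has a
stationary pair $(w,s)$: $s$ lies in the dual ball, maximizes $w^\top u$ there, and equals the
rescaled gradient on $J$ (`exists_isStationary`). When the dual norm of the noise term is at most
$\lambda\eta\rho/2$, the irrepresentability condition puts the rescaled gradient outside $J$
strictly inside the dual ball of the contraction (`IsStationary.dualNorm_contraction_lt`).
Submodularity glues the two pieces into a global certificate, and strictness gives uniqueness
(`mem_dualBall_of_contraction`, `IsStationary.isMinOn_iff`).

The bound on $\lambda$ gives $\|w-w^*\|_\infty<\nu$ (`IsStationary.abs_sub_lt`), hence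
$\mathrm{Supp}(w^*)\subseteq A\subseteq J$ for $A=\mathrm{Supp}(w)$. If $A\ne J$, minimality of $J$
makes $A$ unstable, so some $j\in J\setminus A$ can be added to $A$ without increasing $F$
(`exists_flat_of_ssubset`). The certificate is tight on $A$, which forces $s_j=0$
(`eq_zero_of_flat`): the residual of the problem restricted to $A$ is orthogonal to column $j$. For
fixed $(A,j)$ this has probability zero (`stdGaussian_flat_null`), since moving the noise
orthogonally to the columns in $A$ keeps the fit and changes that correlation. There are finitely
many pairs, so up to a null set the only failure is a large noise term, whose law is that of $\sigma
z/\sqrt n$ (`hasLaw_score`). -/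

theorem conjExp_eq {p : ℝ≥0∞} (hp : 1 < p) : conjExp p = 1 + ((p - 1)⁻¹).toReal := by
  have h : (p - 1)⁻¹ ≠ ∞ := ENNReal.inv_ne_top.2 (tsub_pos_of_lt hp).ne'
  rw [conjExp, ENNReal.conjExponent, ENNReal.toReal_add ENNReal.one_ne_top h, ENNReal.toReal_one]

theorem one_le_conjExp {p : ℝ≥0∞} (hp : 1 < p) : 1 ≤ conjExp p := by
  rw [conjExp_eq hp]
  linarith [ENNReal.toReal_nonneg (a := (p - 1)⁻¹)]

theorem inv_conjExp {p : ℝ≥0∞} (hp : 1 < p) : 1 / conjExp p = 1 - (1 / p).toReal := by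
  rw [conjExp_eq hp]
  rcases eq_or_ne p ∞ with rfl | hpt
  · simp
  · have h1 : 1 < p.toReal := by
      rwa [← ENNReal.toReal_one, ENNReal.toReal_lt_toReal ENNReal.one_ne_top hpt]
    have h2 : (p - 1).toReal = p.toReal - 1 := by
      rw [ENNReal.toReal_sub_of_le hp.le hpt, ENNReal.toReal_one]
    have h3 : p.toReal - 1 ≠ 0 := by linarith
    have h4 : p.toReal ≠ 0 := by linarith
    rw [ENNReal.toReal_inv, h2, one_div p, ENNReal.toReal_inv]
    have h5 : 1 + (p.toReal - 1)⁻¹ = p.toReal / (p.toReal - 1) := by field_simp; ring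
    rw [h5]
    field_simp

/-! ### The dual norm -/

section DualNorm

variable {ι : Type*} {G : Finset ι → ℝ} {p : ℝ≥0∞}

theorem sum_abs_rpow_nonneg (A : Finset ι) (s : ι → ℝ) (q : ℝ) : 0 ≤ ∑ i ∈ A, |s i| ^ q :=
  Finset.sum_nonneg fun _ _ => Real.rpow_nonneg (abs_nonneg _) _

theorem dualNorm_nonneg (hG : ∀ A : Finset ι, A.Nonempty → 0 < G A) (s : ι → ℝ) :
    0 ≤ dualNorm G p s :=
  Real.iSup_nonneg fun A => div_nonneg (Real.rpow_nonneg (sum_abs_rpow_nonneg _ _ _) _)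
    (Real.rpow_nonneg (hG A.1 A.2).le _)

theorem dualNorm_le_iff [Finite ι] (hG : ∀ A : Finset ι, A.Nonempty → 0 < G A) {c : ℝ}
    (hc : 0 ≤ c) (s : ι → ℝ) :
    dualNorm G p s ≤ c ↔ ∀ A : Finset ι, A.Nonempty →
      (∑ i ∈ A, |s i| ^ conjExp p) ^ (1 / conjExp p) ≤ c * G A ^ (1 / conjExp p) := by
  have hpos : ∀ A : Finset ι, A.Nonempty → 0 < G A ^ (1 / conjExp p) :=
    fun A hA => Real.rpow_pos_of_pos (hG A hA) _
  constructor
  · intro h A hA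
    rw [← div_le_iff₀ (hpos A hA)]
    exact (le_ciSup (f := fun A : {A : Finset ι // A.Nonempty} =>
      (∑ i ∈ A.1, |s i| ^ conjExp p) ^ (1 / conjExp p) / G A.1 ^ (1 / conjExp p))
      (Set.finite_range _).bddAbove ⟨A, hA⟩).trans h
  · intro h
    exact Real.iSup_le (fun A => (div_le_iff₀ (hpos A.1 A.2)).2 (h A.1 A.2)) hc

theorem rpow_sum_le_dualNorm_mul [Finite ι] (hG : ∀ A : Finset ι, A.Nonempty → 0 < G A)
    (s : ι → ℝ) {A : Finset ι} (hA : A.Nonempty) :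
    (∑ i ∈ A, |s i| ^ conjExp p) ^ (1 / conjExp p) ≤ dualNorm G p s * G A ^ (1 / conjExp p) :=
  (dualNorm_le_iff hG (dualNorm_nonneg hG s) s).1 le_rfl A hA

theorem dualNorm_add_le [Finite ι] (hp : 1 < p) (hG : ∀ A : Finset ι, A.Nonempty → 0 < G A)
    (s t : ι → ℝ) : dualNorm G p (s + t) ≤ dualNorm G p s + dualNorm G p t := by
  rw [dualNorm_le_iff hG (add_nonneg (dualNorm_nonneg hG s) (dualNorm_nonneg hG t))]
  intro A hA
  rw [add_mul]
  exact (Real.Lp_add_le A s t (one_le_conjExp hp)).trans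
    (add_le_add (rpow_sum_le_dualNorm_mul hG s hA) (rpow_sum_le_dualNorm_mul hG t hA))

theorem dualNorm_smul (hp : 1 < p) (c : ℝ) (s : ι → ℝ) :
    dualNorm G p (c • s) = |c| * dualNorm G p s := by
  have hq : 0 < conjExp p := one_pos.trans_le (one_le_conjExp hp)
  rw [dualNorm, dualNorm, Real.mul_iSup_of_nonneg (abs_nonneg c)]
  congr 1
  funext A
  rw [← mul_div_assoc]
  congr 1
  simp_rw [Pi.smul_apply, smul_eq_mul, abs_mul,
    Real.mul_rpow (abs_nonneg _) (abs_nonneg _), ← Finset.mul_sum]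
  rw [Real.mul_rpow (Real.rpow_nonneg (abs_nonneg _) _) (sum_abs_rpow_nonneg _ _ _),
    ← Real.rpow_mul (abs_nonneg c), mul_one_div_cancel hq.ne', Real.rpow_one]

theorem dualNorm_mono [Finite ι] (hp : 1 < p) (hG : ∀ A : Finset ι, A.Nonempty → 0 < G A)
    {s t : ι → ℝ} (h : ∀ i, |s i| ≤ |t i|) : dualNorm G p s ≤ dualNorm G p t := by
  have hq : 0 < conjExp p := one_pos.trans_le (one_le_conjExp hp)
  rw [dualNorm_le_iff hG (dualNorm_nonneg hG t)]
  intro A hA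
  refine le_trans ?_ (rpow_sum_le_dualNorm_mul hG t hA)
  refine Real.rpow_le_rpow (sum_abs_rpow_nonneg _ _ _) (Finset.sum_le_sum fun i _ => ?_)
    (one_div_nonneg.2 hq.le)
  exact Real.rpow_le_rpow (abs_nonneg _) (h i) hq.le

theorem measurable_dualNorm [Finite ι] : Measurable (dualNorm G p) := by
  unfold dualNorm
  refine Measurable.iSup fun A => ?_
  fun_prop

/-! ### The unit ball of the dual norm -/

/-- The unit ball of the dual norm `Ω_p^*`, for the conjugate exponent `q`. -/
def dualBall (G : Finset ι → ℝ) (q : ℝ) : Set (ι → ℝ) :=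
  {s | ∀ A : Finset ι, ∑ i ∈ A, |s i| ^ q ≤ G A}

theorem dualNorm_le_one_iff [Finite ι] (hp : 1 < p) (hG0 : 0 ≤ G ∅)
    (hG : ∀ A : Finset ι, A.Nonempty → 0 < G A) (s : ι → ℝ) :
    dualNorm G p s ≤ 1 ↔ s ∈ dualBall G (conjExp p) := by
  have hq : 0 < conjExp p := one_pos.trans_le (one_le_conjExp hp)
  rw [dualNorm_le_iff hG zero_le_one]
  constructor
  · intro h A
    rcases A.eq_empty_or_nonempty with rfl | hA
    · simpa using hG0
    · have := h A hA
      rw [one_mul] at this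
      exact (Real.rpow_le_rpow_iff (sum_abs_rpow_nonneg _ _ _) (hG A hA).le
        (one_div_pos.2 hq)).1 this
  · intro h A hA
    rw [one_mul]
    exact Real.rpow_le_rpow (sum_abs_rpow_nonneg _ _ _) (h A) (one_div_pos.2 hq).le

theorem convex_dualBall {q : ℝ} (hq : 1 ≤ q) : Convex ℝ (dualBall G q) := by
  intro s hs t ht a b ha hb hab A
  calc ∑ i ∈ A, |(a • s + b • t) i| ^ q ≤ ∑ i ∈ A, (a * |s i| ^ q + b * |t i| ^ q) := by
        refine Finset.sum_le_sum fun i _ => ?_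
        refine le_trans (Real.rpow_le_rpow (abs_nonneg _) ?_ (by linarith))
          ((convexOn_rpow hq).2 (Set.mem_Ici.2 (abs_nonneg (s i)))
            (Set.mem_Ici.2 (abs_nonneg (t i))) ha hb hab)
        calc |(a • s + b • t) i| ≤ |a * s i| + |b * t i| := abs_add_le _ _
          _ = a • |s i| + b • |t i| := by
            rw [abs_mul, abs_mul, abs_of_nonneg ha, abs_of_nonneg hb, smul_eq_mul, smul_eq_mul]
    _ = a * ∑ i ∈ A, |s i| ^ q + b * ∑ i ∈ A, |t i| ^ q := by
        rw [Finset.sum_add_distrib, Finset.mul_sum, Finset.mul_sum]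
    _ ≤ a * G A + b * G A := by gcongr; exacts [hs A, ht A]
    _ = G A := by rw [← add_mul, hab, one_mul]

theorem neg_mem_dualBall {q : ℝ} {s : ι → ℝ} (hs : s ∈ dualBall G q) : -s ∈ dualBall G q := by
  intro A
  simpa using hs A

theorem zero_mem_dualBall {q : ℝ} (hq : 0 < q) (hG : ∀ A, 0 ≤ G A) :
    (0 : ι → ℝ) ∈ dualBall G q := by
  intro A
  simpa [Real.zero_rpow hq.ne'] using hG A

theorem abs_le_of_mem_dualBall {q : ℝ} (hq : 0 < q) {s : ι → ℝ}
    (hs : s ∈ dualBall G q) (i : ι) : |s i| ≤ G {i} ^ (1 / q) := by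
  have h := hs {i}
  rw [Finset.sum_singleton] at h
  calc |s i| = (|s i| ^ q) ^ (1 / q) := by
        rw [← Real.rpow_mul (abs_nonneg _), mul_one_div_cancel hq.ne', Real.rpow_one]
    _ ≤ G {i} ^ (1 / q) :=
        Real.rpow_le_rpow (Real.rpow_nonneg (abs_nonneg _) _) h (one_div_pos.2 hq).le

theorem isCompact_dualBall [Finite ι] {q : ℝ} (hq : 0 < q) : IsCompact (dualBall G q) := by
  have hsub : dualBall G q ⊆ Set.univ.pi fun i => Set.Icc (-(G {i} ^ (1 / q))) (G {i} ^ (1 / q)) :=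
    fun s hs i _ => abs_le.1 (abs_le_of_mem_dualBall hq hs i)
  refine (isCompact_univ_pi fun i => isCompact_Icc).of_isClosed_subset ?_ hsub
  have : dualBall G q = ⋂ A : Finset ι, {s | ∑ i ∈ A, |s i| ^ q ≤ G A} := by
    ext s; simp [dualBall]
  rw [this]
  refine isClosed_iInter fun A => isClosed_le ?_ continuous_const
  exact continuous_finsetSum _ fun i _ =>
    (continuous_apply i).abs.rpow_const fun _ => Or.inr hq.le

/-! ### The primal norm -/

variable [Fintype ι]

theorem bddAbove_primalNorm (hp : 1 < p) (hG0 : 0 ≤ G ∅)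
    (hG : ∀ A : Finset ι, A.Nonempty → 0 < G A) (w : ι → ℝ) :
    BddAbove (Set.range fun s : {s : ι → ℝ // dualNorm G p s ≤ 1} => w ⬝ᵥ s.1) := by
  have hq : 0 < conjExp p := one_pos.trans_le (one_le_conjExp hp)
  refine ⟨∑ i, |w i| * G {i} ^ (1 / conjExp p), ?_⟩
  rintro _ ⟨s, rfl⟩
  refine Finset.sum_le_sum fun i _ => ?_
  have h := abs_le_of_mem_dualBall hq ((dualNorm_le_one_iff hp hG0 hG s.1).1 s.2) i
  calc w i * s.1 i ≤ |w i * s.1 i| := le_abs_self _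
    _ = |w i| * |s.1 i| := abs_mul _ _
    _ ≤ _ := by gcongr

theorem dotProduct_le_primalNorm (hp : 1 < p) (hG0 : 0 ≤ G ∅)
    (hG : ∀ A : Finset ι, A.Nonempty → 0 < G A) (w : ι → ℝ) {s : ι → ℝ}
    (hs : s ∈ dualBall G (conjExp p)) : w ⬝ᵥ s ≤ primalNorm G p w :=
  le_ciSup (bddAbove_primalNorm hp hG0 hG w) ⟨s, (dualNorm_le_one_iff hp hG0 hG s).2 hs⟩

theorem primalNorm_nonneg (hp : 1 < p) (hG0 : 0 ≤ G ∅)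
    (hG : ∀ A : Finset ι, A.Nonempty → 0 < G A) (w : ι → ℝ) : 0 ≤ primalNorm G p w := by
  have hq : 0 < conjExp p := one_pos.trans_le (one_le_conjExp hp)
  have h0 : ∀ A, 0 ≤ G A := fun A =>
    A.eq_empty_or_nonempty.elim (fun h => h ▸ hG0) fun h => (hG A h).le
  simpa using dotProduct_le_primalNorm hp hG0 hG w (zero_mem_dualBall hq h0)

theorem primalNorm_eq_of_forall_le (hp : 1 < p) (hG0 : 0 ≤ G ∅)
    (hG : ∀ A : Finset ι, A.Nonempty → 0 < G A) {w s : ι → ℝ}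
    (hs : s ∈ dualBall G (conjExp p)) (h : ∀ u ∈ dualBall G (conjExp p), w ⬝ᵥ u ≤ w ⬝ᵥ s) :
    primalNorm G p w = w ⬝ᵥ s := by
  have : Nonempty {s : ι → ℝ // dualNorm G p s ≤ 1} := ⟨⟨s, (dualNorm_le_one_iff hp hG0 hG s).2 hs⟩⟩
  exact le_antisymm (ciSup_le fun u => h u.1 ((dualNorm_le_one_iff hp hG0 hG u.1).1 u.2))
    (dotProduct_le_primalNorm hp hG0 hG w hs)

/-- The generalized Hölder inequality between a norm and its dual. -/
theorem abs_dotProduct_le (hp : 1 < p) (hG0 : 0 ≤ G ∅)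
    (hG : ∀ A : Finset ι, A.Nonempty → 0 < G A) (w s : ι → ℝ) {c : ℝ} (hc : 0 < c)
    (hs : dualNorm G p s ≤ c) : |w ⬝ᵥ s| ≤ c * primalNorm G p w := by
  have h1 : c⁻¹ • s ∈ dualBall G (conjExp p) := by
    rw [← dualNorm_le_one_iff hp hG0 hG, dualNorm_smul hp, abs_of_pos (inv_pos.2 hc),
      inv_mul_le_iff₀ hc, mul_one]
    exact hs
  have h2 := dotProduct_le_primalNorm hp hG0 hG w h1
  have h3 := dotProduct_le_primalNorm hp hG0 hG w (neg_mem_dualBall h1)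
  rw [dotProduct_neg] at h3
  rw [dotProduct_smul, smul_eq_mul] at h2 h3
  rw [abs_le]
  constructor
  · have := mul_le_mul_of_nonneg_left h3 hc.le
    rw [mul_neg, mul_inv_cancel_left₀ hc.ne'] at this
    linarith
  · have := mul_le_mul_of_nonneg_left h2 hc.le
    rwa [mul_inv_cancel_left₀ hc.ne'] at this

end DualNorm


/-- Uncrossing: the left side is modular and $F$ is submodular, so two tight constraints leave no
slack at the union. -/
theorem sum_union_eq_of_tight {ι : Type*} [DecidableEq ι] {F : Finset ι → ℝ} {q : ℝ}
    (hFsub : ∀ A B : Finset ι, F (A ∪ B) + F (A ∩ B) ≤ F A + F B)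
    {s : ι → ℝ} (hs : s ∈ dualBall F q) {D E : Finset ι}
    (hD : ∑ j ∈ D, |s j| ^ q = F D) (hE : ∑ j ∈ E, |s j| ^ q = F E) :
    ∑ j ∈ D ∪ E, |s j| ^ q = F (D ∪ E) := by
  have h1 := Finset.sum_union_inter (s₁ := D) (s₂ := E) (f := fun j => |s j| ^ q)
  have h2 := hFsub D E
  have h3 := hs (D ∩ E)
  exact le_antisymm (hs _) (by linarith)

/-! ### Restricted optimality conditions and their dependence on the data -/

section Stationary

variable {ι m : Type*} [Fintype ι] [Fintype m]

/-- `w` and the dual certificate `s` satisfy the optimality conditions of the problem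
`min ½ ‖y - X w‖² + μ Ω(w)` over the vectors `w` supported in `A`. -/
structure IsStationary (F : Finset ι → ℝ) (q : ℝ) (X : Matrix m ι ℝ) (μ : ℝ) (A : Finset ι)
    (y : m → ℝ) (w s : ι → ℝ) : Prop where
  eq_zero : ∀ i, i ∉ A → w i = 0
  mem : s ∈ dualBall F q
  le : ∀ u ∈ dualBall F q, w ⬝ᵥ u ≤ w ⬝ᵥ s
  grad : ∀ i ∈ A, (Xᵀ *ᵥ (y - X *ᵥ w)) i = μ * s i

theorem dotProduct_congr_of_eq_zero {A : Finset ι} {w a b : ι → ℝ} (hw : ∀ i, i ∉ A → w i = 0)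
    (h : ∀ i ∈ A, a i = b i) : w ⬝ᵥ a = w ⬝ᵥ b := by
  refine Finset.sum_congr rfl fun i _ => ?_
  by_cases hi : i ∈ A
  · rw [h i hi]
  · rw [hw i hi, zero_mul, zero_mul]

theorem mulVec_dotProduct_eq (X : Matrix m ι ℝ) (w : ι → ℝ) (v : m → ℝ) :
    (X *ᵥ w) ⬝ᵥ v = w ⬝ᵥ (Xᵀ *ᵥ v) := by
  rw [Matrix.dotProduct_mulVec, Matrix.vecMul_transpose]

variable {F : Finset ι → ℝ} {q : ℝ} {X : Matrix m ι ℝ} {μ : ℝ} {A : Finset ι}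

/-- Maximizers of linear forms over a fixed set are monotone, $(w-w')^\top(s-s')\ge0$, and the
gradient equations turn this into firm nonexpansiveness of the fit. -/
theorem IsStationary.fit_dotProduct_le {y y' : m → ℝ} {w s w' s' : ι → ℝ} (hμ : 0 ≤ μ)
    (h : IsStationary F q X μ A y w s) (h' : IsStationary F q X μ A y' w' s') :
    (X *ᵥ w - X *ᵥ w') ⬝ᵥ (X *ᵥ w - X *ᵥ w') ≤ (X *ᵥ w - X *ᵥ w') ⬝ᵥ (y - y') := by
  have hs : 0 ≤ (w - w') ⬝ᵥ (s - s') := by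
    have h1 := h.le s' h'.mem
    have h2 := h'.le s h.mem
    rw [sub_dotProduct, dotProduct_sub, dotProduct_sub]
    linarith
  have hz : ∀ i, i ∉ A → (w - w') i = 0 := fun i hi => by
    rw [Pi.sub_apply, h.eq_zero i hi, h'.eq_zero i hi, sub_zero]
  have hg : (w - w') ⬝ᵥ (Xᵀ *ᵥ ((y - y') - (X *ᵥ w - X *ᵥ w'))) = (w - w') ⬝ᵥ (μ • (s - s')) := by
    refine dotProduct_congr_of_eq_zero hz fun i hi => ?_
    have e : (y - y') - (X *ᵥ w - X *ᵥ w') = (y - X *ᵥ w) - (y' - X *ᵥ w') := by abel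
    rw [e, Matrix.mulVec_sub, Pi.sub_apply, h.grad i hi, h'.grad i hi, Pi.smul_apply,
      Pi.sub_apply, smul_eq_mul, mul_sub]
  rw [← mulVec_dotProduct_eq, dotProduct_smul, smul_eq_mul, Matrix.mulVec_sub, dotProduct_sub] at hg
  nlinarith [mul_nonneg hμ hs]

theorem IsStationary.fit_sub_sq_le {y y' : m → ℝ} {w s w' s' : ι → ℝ} (hμ : 0 ≤ μ)
    (h : IsStationary F q X μ A y w s) (h' : IsStationary F q X μ A y' w' s') :
    (X *ᵥ w - X *ᵥ w') ⬝ᵥ (X *ᵥ w - X *ᵥ w') ≤ (y - y') ⬝ᵥ (y - y') := by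
  have h1 := h.fit_dotProduct_le hμ h'
  have h2 : 0 ≤ ((X *ᵥ w - X *ᵥ w') - (y - y')) ⬝ᵥ ((X *ᵥ w - X *ᵥ w') - (y - y')) :=
    Finset.sum_nonneg fun i _ => mul_self_nonneg _
  generalize X *ᵥ w - X *ᵥ w' = a at *
  generalize y - y' = b at *
  rw [sub_dotProduct, dotProduct_sub, dotProduct_sub, dotProduct_comm b a] at h2
  linarith

/-- The right side of firm nonexpansiveness only sees $y-y'$ through the columns in $A$. With $y=y'$
this is uniqueness of the fit. -/
theorem IsStationary.fit_eq {y y' : m → ℝ} {w s w' s' : ι → ℝ} (hμ : 0 ≤ μ)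
    (h : IsStationary F q X μ A y w s) (h' : IsStationary F q X μ A y' w' s')
    (hy : ∀ i ∈ A, (Xᵀ *ᵥ (y - y')) i = 0) : X *ᵥ w = X *ᵥ w' := by
  have h1 := h.fit_dotProduct_le hμ h'
  have hz : ∀ i, i ∉ A → (w - w') i = 0 := fun i hi => by
    rw [Pi.sub_apply, h.eq_zero i hi, h'.eq_zero i hi, sub_zero]
  have h2 : (X *ᵥ w - X *ᵥ w') ⬝ᵥ (y - y') = 0 := by
    rw [← Matrix.mulVec_sub, mulVec_dotProduct_eq,
      dotProduct_congr_of_eq_zero hz (b := 0) (fun i hi => hy i hi), dotProduct_zero]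
  rw [h2] at h1
  have h3 : 0 ≤ (X *ᵥ w - X *ᵥ w') ⬝ᵥ (X *ᵥ w - X *ᵥ w') :=
    Finset.sum_nonneg fun i _ => mul_self_nonneg _
  exact sub_eq_zero.1 (dotProduct_self_eq_zero.1 (le_antisymm h1 h3))

theorem IsStationary.mono {B : Finset ι} {y : m → ℝ} {w s : ι → ℝ}
    (h : IsStationary F q X μ B y w s) (hAB : A ⊆ B) (hw : ∀ i, i ∉ A → w i = 0) :
    IsStationary F q X μ A y w s :=
  ⟨hw, h.mem, h.le, fun i hi => h.grad i (hAB hi)⟩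

/-! ### Existence of stationary pairs -/

/-- The first-order condition for minimizing a quadratic form over a compact convex set. -/
theorem exists_forall_dotProduct_le {K : Set (ι → ℝ)} (hK : IsCompact K) (hKc : Convex ℝ K)
    (hne : K.Nonempty) {M : Matrix ι ι ℝ} (hM : M.IsSymm) (b : ι → ℝ) (hμ : 0 < μ) :
    ∃ s ∈ K, ∀ u ∈ K, (M *ᵥ (b - μ • s)) ⬝ᵥ u ≤ (M *ᵥ (b - μ • s)) ⬝ᵥ s := by
  obtain ⟨s, hs, hmin⟩ := hK.exists_isMinOn hne
    (f := fun s : ι → ℝ => (b - μ • s) ⬝ᵥ (M *ᵥ (b - μ • s)))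
    (by
      have : Continuous fun s : ι → ℝ => (b - μ • s) ⬝ᵥ (M *ᵥ (b - μ • s)) := by fun_prop
      exact this.continuousOn)
  refine ⟨s, hs, fun u hu => ?_⟩
  set c := b - μ • s with hc
  set e := u - s with he
  have hsymm : ∀ a a' : ι → ℝ, a ⬝ᵥ (M *ᵥ a') = a' ⬝ᵥ (M *ᵥ a) := fun a a' => by
    rw [Matrix.dotProduct_mulVec, dotProduct_comm, ← Matrix.mulVec_transpose, hM.eq]
  -- Compare $s$ with the feasible point $s+t(u-s)$ and divide by $\mu t$.
  have key : ∀ t : ℝ, 0 < t → t ≤ 1 → 2 * ((M *ᵥ c) ⬝ᵥ e) ≤ t * (μ * (e ⬝ᵥ (M *ᵥ e))) := by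
    intro t ht0 ht1
    have hmem : s + t • e ∈ K := by
      have := hKc hs hu (sub_nonneg.2 ht1) ht0.le (by ring)
      convert this using 1
      rw [he, sub_smul, smul_sub, one_smul]; abel
    have e1 : b - μ • (s + t • e) = c - (μ * t) • e := by
      rw [hc, smul_add, smul_smul]; abel
    have h : c ⬝ᵥ (M *ᵥ c) ≤ (c - (μ * t) • e) ⬝ᵥ (M *ᵥ (c - (μ * t) • e)) := by
      rw [← e1]; exact hmin hmem
    clear_value c e
    rw [Matrix.mulVec_sub, Matrix.mulVec_smul, sub_dotProduct, dotProduct_sub, dotProduct_sub,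
      smul_dotProduct, smul_dotProduct, dotProduct_smul, dotProduct_smul, hsymm c e] at h
    simp only [smul_eq_mul] at h
    rw [dotProduct_comm (M *ᵥ c) e]
    have h' : (μ * t) * (2 * (e ⬝ᵥ (M *ᵥ c))) ≤ (μ * t) * (t * (μ * (e ⬝ᵥ (M *ᵥ e)))) := by
      linarith
    exact le_of_mul_le_mul_left h' (mul_pos hμ ht0)
  have hle : (M *ᵥ c) ⬝ᵥ e ≤ 0 := by
    by_contra! hpos
    set D := μ * (e ⬝ᵥ (M *ᵥ e)) with hD
    have h1 := key 1 one_pos le_rfl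
    have hDpos : 0 < D := by linarith
    -- This $t$ makes the right side of `key` half of the left side.
    have h2 := key ((M *ᵥ c ⬝ᵥ e) / D) (div_pos hpos hDpos) ((div_le_one hDpos).2 (by linarith))
    rw [div_mul_cancel₀ _ hDpos.ne'] at h2
    linarith
  rw [he, dotProduct_sub] at hle
  linarith

variable [DecidableEq ι]

/-- The inverse of the `A`-block of `Xᵀ X`, padded with zeros. -/
theorem exists_padded_inverse (hX : ∀ v : ι → ℝ, (∀ i, i ∉ A → v i = 0) → X *ᵥ v = 0 → v = 0) :
    ∃ M : Matrix ι ι ℝ, M.IsSymm ∧ ∀ v, (∀ i, i ∉ A → (M *ᵥ v) i = 0) ∧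
      ∀ i ∈ A, (Xᵀ *ᵥ (X *ᵥ (M *ᵥ v))) i = v i := by
  set D : Matrix ι ι ℝ := Matrix.diagonal fun i => if i ∈ A then 1 else 0 with hD
  have hDapp : ∀ v i, (D *ᵥ v) i = if i ∈ A then v i else 0 := fun v i => by
    rw [hD, Matrix.mulVec_diagonal]; split_ifs <;> simp
  have hDD : D * D = D := by
    rw [hD, Matrix.diagonal_mul_diagonal]; congr 1; funext i; split_ifs <;> simp
  have hDt : Dᵀ = D := Matrix.diagonal_transpose _
  -- Block diagonal: the Gram block on $A$ and the identity off $A$, so that an honest inverse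
  -- exists and $DN^{-1}$ is the padded one.
  set N : Matrix ι ι ℝ := D * (Xᵀ * X) * D + (1 - D) with hN
  have hDN : D * N = D * (Xᵀ * X) * D := by
    rw [hN, mul_add, ← mul_assoc, ← mul_assoc, hDD, mul_sub, hDD, mul_one, sub_self, add_zero]
  have hND : N * D = D * (Xᵀ * X) * D := by
    rw [hN, add_mul, mul_assoc, hDD, sub_mul, hDD, one_mul, sub_self, add_zero]
  have hNt : Nᵀ = N := by
    rw [hN]
    simp only [Matrix.transpose_add, Matrix.transpose_mul, Matrix.transpose_sub, hDt,
      Matrix.transpose_one, Matrix.transpose_transpose, mul_assoc]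
  have hinj : Function.Injective N.mulVec := by
    rw [← Matrix.coe_mulVecLin, injective_iff_map_eq_zero]
    intro v hv
    rw [Matrix.mulVecLin_apply] at hv
    have h1 : (D * (Xᵀ * X) * D) *ᵥ v = 0 := by
      rw [← hDN, ← Matrix.mulVec_mulVec, hv, Matrix.mulVec_zero]
    have h2 : v = D *ᵥ v := by
      have : N *ᵥ v = (D * (Xᵀ * X) * D) *ᵥ v + (v - D *ᵥ v) := by
        rw [hN, Matrix.add_mulVec, Matrix.sub_mulVec, Matrix.one_mulVec]
      rw [hv, h1, zero_add] at this
      exact sub_eq_zero.1 this.symm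
    have h3 : (X *ᵥ v) ⬝ᵥ (X *ᵥ v) = 0 := by
      have h4 : v ⬝ᵥ (D * (Xᵀ * X) * D) *ᵥ v = 0 := by rw [h1, dotProduct_zero]
      rwa [← Matrix.mulVec_mulVec, ← h2, ← Matrix.mulVec_mulVec, Matrix.dotProduct_mulVec,
        ← Matrix.mulVec_transpose, hDt, ← h2, ← Matrix.mulVec_mulVec, ← mulVec_dotProduct_eq] at h4
    refine hX v (fun i hi => ?_) (dotProduct_self_eq_zero.1 h3)
    rw [h2, hDapp, if_neg hi]
  have hunit : IsUnit N.det :=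
    (Matrix.isUnit_iff_isUnit_det N).1 (Matrix.mulVec_injective_iff_isUnit.1 hinj)
  have hcomm : D * N⁻¹ = N⁻¹ * D := by
    calc D * N⁻¹ = N⁻¹ * (N * D) * N⁻¹ := by
          rw [← mul_assoc, Matrix.nonsing_inv_mul _ hunit, one_mul]
      _ = N⁻¹ * (D * N) * N⁻¹ := by rw [hND, hDN]
      _ = N⁻¹ * D := by rw [mul_assoc, mul_assoc, Matrix.mul_nonsing_inv _ hunit, mul_one]
  refine ⟨D * N⁻¹, ?_, fun v => ⟨fun i hi => ?_, fun i hi => ?_⟩⟩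
  · rw [Matrix.IsSymm, Matrix.transpose_mul, Matrix.transpose_nonsing_inv, hNt, hDt, hcomm]
  · rw [← Matrix.mulVec_mulVec, hDapp, if_neg hi]
  · have h1 : D * (Xᵀ * X) * (D * N⁻¹) = D := by
      rw [← mul_assoc, ← hDN, mul_assoc, Matrix.mul_nonsing_inv _ hunit, mul_one]
    have h2 : (D *ᵥ (Xᵀ *ᵥ (X *ᵥ ((D * N⁻¹) *ᵥ v)))) i = (D *ᵥ v) i := by
      simp only [Matrix.mulVec_mulVec]
      rw [← Matrix.mul_assoc Xᵀ, ← mul_assoc D (Xᵀ * X), h1]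
    rwa [hDapp, hDapp, if_pos hi, if_pos hi] at h2

/-- With $w=M(X^\top y-\mu s)$ the gradient equation holds on $A$ for every $s$. The remaining
maximality of $s$ is the first-order condition of a quadratic problem over the compact dual ball. -/
theorem exists_isStationary (hF : ∀ B, 0 ≤ F B) (hq : 1 ≤ q) (hμ : 0 < μ)
    (hX : ∀ v : ι → ℝ, (∀ i, i ∉ A → v i = 0) → X *ᵥ v = 0 → v = 0) (y : m → ℝ) :
    ∃ w s, IsStationary F q X μ A y w s := by
  obtain ⟨M, hM, hMv⟩ := exists_padded_inverse hX
  have hq0 : 0 < q := one_pos.trans_le hq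
  obtain ⟨s, hs, hle⟩ := exists_forall_dotProduct_le (isCompact_dualBall hq0)
    (convex_dualBall hq) ⟨0, zero_mem_dualBall hq0 hF⟩ hM (Xᵀ *ᵥ y) hμ
  refine ⟨M *ᵥ (Xᵀ *ᵥ y - μ • s), s, (hMv _).1, hs, hle, fun i hi => ?_⟩
  rw [Matrix.mulVec_sub, Pi.sub_apply, (hMv _).2 i hi, Pi.sub_apply, Pi.smul_apply, smul_eq_mul]
  ring

/-! ### The certificate on flat directions of the set-function -/

/-- If every constraint through $i$ had slack, $|s_i|$ could be enlarged with the sign of $w_i$,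
improving the linear form. Zeroing $s$ off the support of $w$ costs nothing and, by monotonicity of
$F$, places the tight set inside the support. -/
theorem exists_tight_of_forall_le (hFmono : ∀ A B : Finset ι, A ⊆ B → F A ≤ F B) (hq : 0 < q)
    {w s : ι → ℝ} (hs : s ∈ dualBall F q)
    (hle : ∀ u ∈ dualBall F q, w ⬝ᵥ u ≤ w ⬝ᵥ s) {i : ι} (hi : w i ≠ 0) :
    ∃ D : Finset ι, i ∈ D ∧ (∀ j ∈ D, w j ≠ 0) ∧ ∑ j ∈ D, |s j| ^ q = F D := by
  set A : Finset ι := Finset.univ.filter fun j => w j ≠ 0 with hA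
  have hmemA : ∀ j, j ∈ A ↔ w j ≠ 0 := fun j => by simp [hA]
  suffices h : ∃ D : Finset ι, i ∈ D ∧ F D ≤ ∑ j ∈ D ∩ A, |s j| ^ q by
    obtain ⟨D, hiD, hD⟩ := h
    refine ⟨D ∩ A, Finset.mem_inter.2 ⟨hiD, (hmemA i).2 hi⟩,
      fun j hj => (hmemA j).1 (Finset.mem_inter.1 hj).2, le_antisymm (hs _) ?_⟩
    exact (hFmono _ _ Finset.inter_subset_left).trans hD
  by_contra! hlt
  obtain ⟨D₀, hD₀, hmin⟩ := Finset.exists_min_image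
    (Finset.univ.filter fun D : Finset ι => i ∈ D) (fun D => F D - ∑ j ∈ D ∩ A, |s j| ^ q)
    ⟨{i}, by simp⟩
  set δ := F D₀ - ∑ j ∈ D₀ ∩ A, |s j| ^ q with hδ
  have hδ0 : 0 < δ := sub_pos.2 (hlt D₀ (by simpa using hD₀))
  have hsi : 0 ≤ |s i| ^ q := Real.rpow_nonneg (abs_nonneg _) _
  -- The value that uses up exactly the smallest slack $\delta$ among the sets containing $i$.
  set a := (|s i| ^ q + δ) ^ (1 / q) with ha
  have ha0 : 0 ≤ a := Real.rpow_nonneg (by linarith) _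
  have haq : a ^ q = |s i| ^ q + δ := by
    rw [ha, ← Real.rpow_mul (by linarith), one_div_mul_cancel hq.ne', Real.rpow_one]
  have hsa : |s i| < a := by
    rw [← Real.rpow_lt_rpow_iff (abs_nonneg _) ha0 hq, haq]; linarith
  have hsign : |SignType.sign (w i) * a| = a := by
    rw [abs_mul, abs_of_nonneg ha0]
    rcases lt_or_gt_of_ne hi with h | h <;> simp [h]
  set v : ι → ℝ := fun j => if j ∈ A then s j else 0 with hv
  set u : ι → ℝ := Function.update v i (SignType.sign (w i) * a) with hu
  have hvs : ∀ E : Finset ι, ∑ j ∈ E, |v j| ^ q = ∑ j ∈ E ∩ A, |s j| ^ q := fun E => by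
    rw [← Finset.filter_mem_eq_inter, Finset.sum_filter]
    refine Finset.sum_congr rfl fun j _ => ?_
    simp only [hv]
    split_ifs
    · rfl
    · rw [abs_zero, Real.zero_rpow hq.ne']
  have hvi : v i = s i := if_pos ((hmemA i).2 hi)
  have hmem : u ∈ dualBall F q := by
    intro E
    by_cases hE : i ∈ E
    · have h1 : ∑ j ∈ E, |u j| ^ q = ∑ j ∈ E, |v j| ^ q + δ := by
        rw [← Finset.add_sum_erase E _ hE, ← Finset.add_sum_erase E (fun j => |v j| ^ q) hE,
          hu, Function.update_self, hsign, haq, hvi,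
          Finset.sum_congr rfl fun j hj => by rw [Function.update_of_ne (Finset.ne_of_mem_erase hj)]]
        ring
      rw [h1, hvs]
      linarith [hmin E (by simpa using hE)]
    · have h1 : ∑ j ∈ E, |u j| ^ q = ∑ j ∈ E ∩ A, |s j| ^ q := by
        rw [← hvs]
        refine Finset.sum_congr rfl fun j hj => ?_
        rw [hu, Function.update_of_ne (ne_of_mem_of_not_mem hj hE)]
      rw [h1]
      exact (hs _).trans (hFmono _ _ Finset.inter_subset_left)
  have hgt : w ⬝ᵥ s < w ⬝ᵥ u := by
    refine Finset.sum_lt_sum (fun j _ => ?_) ⟨i, Finset.mem_univ _, ?_⟩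
    · rcases eq_or_ne j i with rfl | hji
      · rw [hu, Function.update_self, ← mul_assoc, self_mul_sign]
        calc w j * s j ≤ |w j| * |s j| := by rw [← abs_mul]; exact le_abs_self _
          _ ≤ |w j| * a := by gcongr
      · rw [hu, Function.update_of_ne hji]
        by_cases hj : j ∈ A
        · simp [hv, hj]
        · rw [not_not.1 (fun h => hj ((hmemA j).2 h)), zero_mul, zero_mul]
    · rw [hu, Function.update_self, ← mul_assoc, self_mul_sign]
      calc w i * s i ≤ |w i| * |s i| := by rw [← abs_mul]; exact le_abs_self _
        _ < |w i| * a := mul_lt_mul_of_pos_left hsa (abs_pos.2 hi)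
  exact absurd (hle u hmem) (not_le.2 hgt)

/-- A maximizer over the dual ball is tight on the support of the linear form. -/
theorem sum_supp_eq (hF : IsPolymatroid F) (hq : 0 < q)
    {w s : ι → ℝ} (hs : s ∈ dualBall F q) (hle : ∀ u ∈ dualBall F q, w ⬝ᵥ u ≤ w ⬝ᵥ s) :
    ∑ j ∈ supp w, |s j| ^ q = F (supp w) := by
  have key : ∀ S : Finset ι, S ⊆ supp w →
      ∃ D : Finset ι, S ⊆ D ∧ D ⊆ supp w ∧ ∑ j ∈ D, |s j| ^ q = F D := by
    intro S
    induction S using Finset.induction_on with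
    | empty => exact fun _ => ⟨∅, le_rfl, Finset.empty_subset _, by simp [hF.empty]⟩
    | insert i S _ ih =>
      intro hS
      obtain ⟨D, hSD, hDw, hD⟩ := ih ((Finset.subset_insert _ _).trans hS)
      have hi : w i ≠ 0 := (Finset.mem_filter.1 (hS (Finset.mem_insert_self _ _))).2
      obtain ⟨E, hiE, hEw, hE⟩ := exists_tight_of_forall_le hF.mono hq hs hle hi
      refine ⟨D ∪ E, Finset.insert_subset (Finset.mem_union_right _ hiE)
        (hSD.trans Finset.subset_union_left), Finset.union_subset hDw fun j hj => ?_,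
        sum_union_eq_of_tight hF.submodular hs hD hE⟩
      exact Finset.mem_filter.2 ⟨Finset.mem_univ _, hEw j hj⟩
  obtain ⟨D, h1, h2, h3⟩ := key _ le_rfl
  rwa [h2.antisymm h1] at h3

/-- The constraint on the support is already saturated, and adding $j$ gives no further budget for
$|s_j|^q$. -/
theorem eq_zero_of_flat (hF : IsPolymatroid F) (hq : 0 < q)
    {w s : ι → ℝ} (hs : s ∈ dualBall F q) (hle : ∀ u ∈ dualBall F q, w ⬝ᵥ u ≤ w ⬝ᵥ s)
    {j : ι} (hj : j ∉ supp w) (hflat : F (insert j (supp w)) ≤ F (supp w)) : s j = 0 := by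
  have h1 := hs (insert j (supp w))
  rw [Finset.sum_insert hj, sum_supp_eq hF hq hs hle] at h1
  have h2 : |s j| ^ q = 0 := le_antisymm (by linarith) (Real.rpow_nonneg (abs_nonneg _) _)
  exact abs_eq_zero.1 ((Real.rpow_eq_zero (abs_nonneg _) hq.ne').1 h2)

end Stationary


/-! ### Gaussian vectors -/

/-- Induction splitting off one coordinate; it lets Lebesgue null sets serve as Gaussian null sets.
-/
theorem pi_absolutelyContinuous {μ ν : Measure ℝ} [SigmaFinite μ] [SigmaFinite ν] (h : μ ≪ ν) :
    ∀ n : ℕ, Measure.pi (fun _ : Fin n => μ) ≪ Measure.pi (fun _ : Fin n => ν)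
  | 0 => by
    rw [Measure.pi_of_empty, Measure.pi_of_empty]
  | n + 1 => by
    have h1 := (measurePreserving_piFinSuccAbove (fun _ : Fin (n + 1) => μ) 0).symm
    have h2 := (measurePreserving_piFinSuccAbove (fun _ : Fin (n + 1) => ν) 0).symm
    rw [← h1.map_eq, ← h2.map_eq]
    exact (h.prod (pi_absolutelyContinuous h n)).map h1.measurable

theorem stdGaussian_absolutelyContinuous (n : ℕ) :
    stdGaussian (EuclideanSpace ℝ (Fin n)) ≪ volume := by
  rw [← map_pi_eq_stdGaussian, ← (PiLp.volume_preserving_toLp (Fin n)).map_eq, volume_pi]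
  exact (pi_absolutelyContinuous (gaussianReal_absolutelyContinuous 0 one_ne_zero) n).map
    (PiLp.volume_preserving_toLp (Fin n)).measurable

theorem inner_eq_dotProduct {n : ℕ} (x y : EuclideanSpace ℝ (Fin n)) :
    inner ℝ x y = (x : Fin n → ℝ) ⬝ᵥ (y : Fin n → ℝ) := by
  rw [EuclideanSpace.inner_eq_star_dotProduct, dotProduct_comm]
  rfl

theorem dotProduct_gram_mulVec {n d : ℕ} (X : Matrix (Fin n) (Fin d) ℝ) (a b : Fin d → ℝ) :
    a ⬝ᵥ (gram X *ᵥ b) = 1 / (n : ℝ) * ((X *ᵥ a) ⬝ᵥ (X *ᵥ b)) := by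
  rw [gram, Matrix.smul_mulVec, dotProduct_smul, smul_eq_mul, ← Matrix.mulVec_mulVec,
    ← mulVec_dotProduct_eq]

theorem posSemidef_gram {n d : ℕ} (X : Matrix (Fin n) (Fin d) ℝ) : (gram X).PosSemidef := by
  have h := Matrix.posSemidef_conjTranspose_mul_self X
  rw [Matrix.conjTranspose_eq_transpose_of_trivial] at h
  exact h.smul (by positivity)

/-- The score `Xᵀ ε / √n` of a standard normal vector has covariance `Q`. -/
theorem hasLaw_score {n d : ℕ} (X : Matrix (Fin n) (Fin d) ℝ) {Ω : Type*} [MeasurableSpace Ω]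
    {P : Measure Ω} {eps : Ω → EuclideanSpace ℝ (Fin n)}
    (heps : HasLaw eps (stdGaussian (EuclideanSpace ℝ (Fin n))) P) :
    HasLaw (fun ω => WithLp.toLp 2 ((1 / √(n : ℝ)) • (Xᵀ *ᵥ (eps ω).ofLp)))
      (multivariateGaussian 0 (gram X)) P := by
  set f : EuclideanSpace ℝ (Fin n) → EuclideanSpace ℝ (Fin d) :=
    fun e => WithLp.toLp 2 ((1 / √(n : ℝ)) • (Xᵀ *ᵥ e.ofLp)) with hf
  have hcont : Continuous f := by
    refine (PiLp.continuous_toLp 2 _).comp ?_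
    fun_prop
  have hlaw : HasLaw f (multivariateGaussian 0 (gram X))
      (stdGaussian (EuclideanSpace ℝ (Fin n))) := by
    refine ⟨hcont.aemeasurable, ?_⟩
    have : IsProbabilityMeasure ((stdGaussian (EuclideanSpace ℝ (Fin n))).map f) :=
      Measure.isProbabilityMeasure_map hcont.aemeasurable
    refine Measure.ext_of_charFun (funext fun t => ?_)
    -- Passing to the adjoint evaluates the characteristic function of the score at $t$ as the
    -- standard Gaussian one at $Xt/\sqrt n$.
    have key : ∀ e, inner ℝ (f e) t =
        inner ℝ e (WithLp.toLp 2 ((1 / √(n : ℝ)) • (X *ᵥ t.ofLp))) := fun e => by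
      rw [inner_eq_dotProduct, inner_eq_dotProduct, hf]
      simp only
      rw [smul_dotProduct, dotProduct_smul, dotProduct_comm (Xᵀ *ᵥ _), ← mulVec_dotProduct_eq,
        dotProduct_comm]
    rw [charFun_apply, integral_map hcont.aemeasurable (by fun_prop)]
    simp_rw [key]
    rw [← charFun_apply, charFun_stdGaussian, charFun_multivariateGaussian (posSemidef_gram X)]
    congr 1
    rw [inner_zero_right, dotProduct_gram_mulVec, ← Complex.ofReal_pow, ← real_inner_self_eq_norm_sq,
      inner_eq_dotProduct]
    simp only
    rw [smul_dotProduct, dotProduct_smul, smul_eq_mul, smul_eq_mul, ← mul_assoc, div_mul_div_comm,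
      Real.mul_self_sqrt n.cast_nonneg, one_mul]
    push_cast
    ring
  exact hlaw.comp heps

/-! ### Flat directions are almost surely not active -/

/-- Take the residual of regressing column $j$ on the columns in $A$. Were it orthogonal to column
$j$ too, it would have norm zero, contradicting independence of the columns. -/
theorem exists_residual {ι m : Type*} [Fintype ι] [Fintype m] [DecidableEq ι]
    {X : Matrix m ι ℝ} {A : Finset ι} {j : ι} (hj : j ∉ A)
    (hX : ∀ v : ι → ℝ, (∀ i, i ∉ insert j A → v i = 0) → X *ᵥ v = 0 → v = 0) :
    ∃ u : m → ℝ, (∀ i ∈ A, (Xᵀ *ᵥ u) i = 0) ∧ (Xᵀ *ᵥ u) j ≠ 0 := by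
  obtain ⟨M, -, hM⟩ := exists_padded_inverse (X := X) (A := A) fun v hv =>
    hX v fun i hi => hv i fun h => hi (Finset.mem_insert_of_mem h)
  set c := M *ᵥ (Xᵀ *ᵥ (X *ᵥ Pi.single j 1)) with hc
  have hcA : ∀ i, i ∉ A → c i = 0 := (hM _).1
  have hA : ∀ i ∈ A, (Xᵀ *ᵥ (X *ᵥ (Pi.single j 1 - c))) i = 0 := fun i hi => by
    rw [Matrix.mulVec_sub, Matrix.mulVec_sub, Pi.sub_apply, hc, (hM _).2 i hi, sub_self]
  refine ⟨X *ᵥ (Pi.single j 1 - c), hA, fun h0 => ?_⟩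
  have h1 : (X *ᵥ (Pi.single j 1 - c)) ⬝ᵥ (X *ᵥ (Pi.single j 1 - c)) = 0 := by
    rw [mulVec_dotProduct_eq, sub_dotProduct, single_dotProduct, h0,
      dotProduct_congr_of_eq_zero hcA (b := 0) hA]
    simp
  have h2 := hX _ (fun i hi => ?_) (dotProduct_self_eq_zero.1 h1)
  · have := congrFun h2 j
    rw [Pi.sub_apply, hcA j hj, Pi.single_eq_same] at this
    norm_num at this
  · rw [Finset.mem_insert, not_or] at hi
    rw [Pi.sub_apply, Pi.single_eq_of_ne hi.1, hcA i hi.2, sub_zero]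

/-- Translating the noise along the direction of `exists_residual` leaves the fit unchanged but
moves the correlation with column $j$. The bad set therefore has infinitely many disjoint translates
by a bounded sequence, which forces measure zero. -/
theorem stdGaussian_flat_null {n d : ℕ} {F : Finset (Fin d) → ℝ} {q μ σ : ℝ}
    {X : Matrix (Fin n) (Fin d) ℝ} {A : Finset (Fin d)} {j : Fin d}
    (hF : ∀ B, 0 ≤ F B) (hq : 1 ≤ q) (hμ : 0 < μ) (hσ : 0 < σ) (hj : j ∉ A)
    (hX : ∀ v : Fin d → ℝ, (∀ i, i ∉ insert j A → v i = 0) → X *ᵥ v = 0 → v = 0)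
    (c : Fin n → ℝ) :
    ∃ N : Set (EuclideanSpace ℝ (Fin n)), MeasurableSet N ∧
      stdGaussian (EuclideanSpace ℝ (Fin n)) N = 0 ∧
      ∀ e w s, IsStationary F q X μ A (c + σ • (e : EuclideanSpace ℝ (Fin n)).ofLp) w s →
        (Xᵀ *ᵥ (c + σ • e.ofLp - X *ᵥ w)) j = 0 → e ∈ N := by
  have hXA : ∀ v : Fin d → ℝ, (∀ i, i ∉ A → v i = 0) → X *ᵥ v = 0 → v = 0 := fun v hv =>
    hX v fun i hi => hv i fun h => hi (Finset.mem_insert_of_mem h)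
  choose w s hws using fun e : EuclideanSpace ℝ (Fin n) =>
    exists_isStationary hF hq hμ hXA (c + σ • e.ofLp)
  -- The solutions `w e` are arbitrary choices; only the fit is shown to be continuous, which
  -- suffices to make `N` closed.
  have hfit : LipschitzWith (Real.toNNReal σ)
      (fun e => WithLp.toLp 2 (X *ᵥ w e) : EuclideanSpace ℝ (Fin n) → EuclideanSpace ℝ (Fin n)) := by
    refine LipschitzWith.of_dist_le_mul fun e e' => ?_
    rw [Real.coe_toNNReal _ hσ.le, dist_eq_norm, dist_eq_norm]
    refine le_of_sq_le_sq ?_ (mul_nonneg hσ.le (norm_nonneg _))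
    rw [mul_pow, ← real_inner_self_eq_norm_sq, ← real_inner_self_eq_norm_sq, inner_eq_dotProduct,
      inner_eq_dotProduct]
    have h := (hws e).fit_sub_sq_le hμ.le (hws e')
    have e1 : c + σ • e.ofLp - (c + σ • e'.ofLp) = σ • (e.ofLp - e'.ofLp) := by
      rw [smul_sub]; abel
    rw [e1, smul_dotProduct, dotProduct_smul, smul_eq_mul, smul_eq_mul, ← mul_assoc, ← pow_two] at h
    exact h
  have hcont : Continuous fun e => X *ᵥ w e :=
    (PiLp.continuous_ofLp 2 _).comp hfit.continuous
  set N : Set (EuclideanSpace ℝ (Fin n)) :=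
    {e | (Xᵀ *ᵥ (c + σ • e.ofLp - X *ᵥ w e)) j = 0} with hN
  have hNm : MeasurableSet N := by
    refine (isClosed_eq ?_ continuous_const).measurableSet
    have h1 : Continuous fun e : EuclideanSpace ℝ (Fin n) => c + σ • e.ofLp - X *ᵥ w e :=
      (continuous_const.add ((PiLp.continuous_ofLp 2 _).const_smul σ)).sub hcont
    exact (continuous_apply j).comp (Continuous.matrix_mulVec continuous_const h1)
  refine ⟨N, hNm, stdGaussian_absolutelyContinuous n ?_, fun e w' s' h h0 => ?_⟩
  · obtain ⟨u, huA, huj⟩ := exists_residual hj hX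
    refine Measure.addHaar_eq_zero_of_disjoint_translates volume
      (fun k : ℕ => (1 / ((k : ℝ) + 1)) • (WithLp.toLp 2 u : EuclideanSpace ℝ (Fin n))) ?_ ?_ hNm
    · rw [isBounded_iff_forall_norm_le]
      refine ⟨‖(WithLp.toLp 2 u : EuclideanSpace ℝ (Fin n))‖, ?_⟩
      rintro _ ⟨k, rfl⟩
      rw [norm_smul, Real.norm_of_nonneg (by positivity)]
      refine mul_le_of_le_one_left (norm_nonneg _) ?_
      rw [div_le_one (by positivity)]
      linarith [k.cast_nonneg (α := ℝ)]
    · intro k l hkl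
      rw [Function.onFun, Set.disjoint_left]
      rintro x hx hx'
      rw [Set.singleton_add, Set.mem_image] at hx hx'
      obtain ⟨e, he, hex⟩ := hx
      obtain ⟨e', he', hex'⟩ := hx'
      set r : ℝ := 1 / ((l : ℝ) + 1) - 1 / ((k : ℝ) + 1) with hr
      have hee : e.ofLp - e'.ofLp = r • u := by
        have h1 : e - e' = r • (WithLp.toLp 2 u : EuclideanSpace ℝ (Fin n)) := by
          rw [hr, sub_smul, sub_eq_sub_iff_add_eq_add, add_comm, hex, hex']
        exact congrArg WithLp.ofLp h1
      have hy : c + σ • e.ofLp - (c + σ • e'.ofLp) = (σ * r) • u := by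
        rw [mul_smul, ← hee, smul_sub]; abel
      have hfe := (hws e).fit_eq hμ.le (hws e') fun i hi => by
        rw [hy, Matrix.mulVec_smul, Pi.smul_apply, huA i hi, smul_zero]
      rw [hN, Set.mem_ofPred_eq] at he he'
      have h2 : (Xᵀ *ᵥ ((σ * r) • u)) j = 0 := by
        rw [← hy]
        have : c + σ • e.ofLp - (c + σ • e'.ofLp) =
            (c + σ • e.ofLp - X *ᵥ w e) - (c + σ • e'.ofLp - X *ᵥ w e') := by rw [hfe]; abel
        rw [this, Matrix.mulVec_sub, Pi.sub_apply, he, he', sub_zero]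
      rw [Matrix.mulVec_smul, Pi.smul_apply, smul_eq_mul] at h2
      have h3 : r = 0 := by
        rcases mul_eq_zero.1 h2 with h | h
        · exact (mul_eq_zero.1 h).resolve_left hσ.ne'
        · exact absurd h huj
      rw [hr, sub_eq_zero, one_div, one_div, inv_inj, add_left_inj, Nat.cast_inj] at h3
      exact hkl h3.symm
  -- Any stationary pair has the fit of the chosen one, so `N` does not depend on the choice.
  · have hfe := h.fit_eq hμ.le (hws e) fun i hi => by rw [sub_self, Matrix.mulVec_zero]; rfl
    rw [hN, Set.mem_ofPred_eq, ← hfe]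
    exact h0


/-! ### Polymatroids, restrictions and contractions -/

section Polymatroid

variable {ι : Type*} [DecidableEq ι] {F : Finset ι → ℝ} {J : Finset ι}

theorem IsPolymatroid.nonneg (hF : IsPolymatroid F) (A : Finset ι) : 0 ≤ F A :=
  hF.empty ▸ hF.mono ∅ A (Finset.empty_subset A)

theorem IsPolymatroid.pos (hF : IsPolymatroid F) (A : Finset ι) (hA : A.Nonempty) : 0 < F A := by
  obtain ⟨k, hk⟩ := hA
  exact (hF.singleton_pos k).trans_le (hF.mono _ _ (Finset.singleton_subset_iff.2 hk))

theorem restriction_pos (hF : IsPolymatroid F) (A : Finset {j // j ∈ J}) (hA : A.Nonempty) :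
    0 < restriction F J A :=
  hF.pos _ (hA.map)

theorem contraction_empty : contraction F J ∅ = 0 := by
  simp [contraction]

theorem contraction_pos (hJ : IsStable F J) (A : Finset {j // j ∉ J}) (hA : A.Nonempty) :
    0 < contraction F J A := by
  refine sub_pos.2 (hJ _ Finset.subset_union_right fun h => ?_)
  obtain ⟨k, hk⟩ := hA
  have : k.1 ∈ A.map (Function.Embedding.subtype fun j => j ∉ J) ∪ J :=
    Finset.mem_union_left _ (Finset.mem_map_of_mem (Function.Embedding.subtype fun j => j ∉ J) hk)
  rw [h] at this
  exact k.2 this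

/-- An unstable $A$ has a proper superset $B$ with no larger value. Submodularity and stability of
$J$ keep $B$ inside $J$, so any element of $B\setminus A$ works. -/
theorem exists_flat_of_ssubset (hF : IsPolymatroid F) {S A : Finset ι}
    (hJ : IsLeast {B : Finset ι | IsStable F B ∧ S ⊆ B} J) (hS : S ⊆ A) (hA : A ⊆ J)
    (hne : A ≠ J) : ∃ j ∈ J, j ∉ A ∧ F (insert j A) ≤ F A := by
  have hns : ¬ IsStable F A := fun h => hne (hA.antisymm (hJ.2 ⟨h, hS⟩))
  rw [IsStable] at hns
  push Not at hns
  obtain ⟨B, hAB, hBA, hle⟩ := hns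
  have hBJ : B ⊆ J := by
    have h1 := hF.submodular B J
    have h2 := hF.mono A (B ∩ J) (Finset.subset_inter hAB hA)
    by_contra h
    have h3 := hJ.1.1 (B ∪ J) Finset.subset_union_right
      fun h' => h (h' ▸ Finset.subset_union_left)
    linarith
  obtain ⟨j, hjB, hjA⟩ := Finset.exists_of_ssubset (hAB.ssubset_of_ne hBA.symm)
  exact ⟨j, hBJ hjB, hjA, (hF.mono _ _ (Finset.insert_subset hjB hAB)).trans hle⟩

/-- Split each sum along $J$: the two budgets add up to $F(A\cap J)+F(A\cup J)-F(J)\le F(A)$. -/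
theorem mem_dualBall_of_contraction [Finite ι] (hF : IsPolymatroid F) (hJ : IsStable F J)
    {p : ℝ≥0∞} (hp : 1 < p) {s t : ι → ℝ} (hs : s ∈ dualBall F (conjExp p))
    (hst : ∀ i ∈ J, t i = s i)
    (ht : dualNorm (contraction F J) p (fun j => t j.1) ≤ 1) : t ∈ dualBall F (conjExp p) := by
  rw [dualNorm_le_one_iff hp contraction_empty.ge (contraction_pos hJ)] at ht
  intro A
  have h1 := ht (A.subtype fun j => j ∉ J)
  rw [contraction, Finset.subtype_map] at h1
  have h1' : ∑ i ∈ A with i ∉ J, |t i| ^ conjExp p ≤ F ((A.filter fun j => j ∉ J) ∪ J) - F J := by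
    rw [← Finset.sum_subtype_eq_sum_filter (fun i => |t i| ^ conjExp p)]
    exact h1
  have h2 : ∑ i ∈ A with i ∈ J, |t i| ^ conjExp p ≤ F (A ∩ J) := by
    rw [Finset.filter_mem_eq_inter]
    refine le_trans (Finset.sum_le_sum fun i hi => ?_) (hs (A ∩ J))
    rw [hst i (Finset.mem_inter.1 hi).2]
  have h3 : (A.filter fun j => j ∉ J) ∪ J = A ∪ J := by
    ext i
    simp only [Finset.mem_union, Finset.mem_filter]
    tauto
  rw [h3] at h1'
  rw [← Finset.sum_filter_add_sum_filter_not A (· ∈ J)]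
  linarith [hF.submodular A J]

theorem dualNorm_restriction_le [Finite ι] (hF : IsPolymatroid F) {p : ℝ≥0∞} (s : ι → ℝ) :
    dualNorm (restriction F J) p (fun j => s j.1) ≤ dualNorm F p s := by
  rw [dualNorm_le_iff (restriction_pos hF) (dualNorm_nonneg hF.pos s)]
  intro A hA
  have h := rpow_sum_le_dualNorm_mul (p := p) hF.pos s (hA.map (f := Function.Embedding.subtype _))
  rwa [Finset.sum_map] at h

/-! ### The constant `ρ` -/

theorem rho_le [Finite ι] {A B : Finset ι} (hAB : A ⊆ B) (h : F A < F B) :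
    rho F ≤ (F B - F A) / F (B \ A) :=
  ciInf_le (f := fun P : {P : Finset ι × Finset ι // P.1 ⊆ P.2 ∧ F P.1 < F P.2} =>
    (F P.1.2 - F P.1.1) / F (P.1.2 \ P.1.1)) (Set.finite_range _).bddBelow ⟨(A, B), hAB, h⟩

theorem rho_le_one [Finite ι] [Nonempty ι] (hF : IsPolymatroid F) : rho F ≤ 1 := by
  obtain ⟨k⟩ := ‹Nonempty ι›
  have h := rho_le (F := F) (Finset.empty_subset {k}) (by rw [hF.empty]; exact hF.singleton_pos k)
  rwa [hF.empty, sub_zero, Finset.sdiff_empty, div_self (hF.singleton_pos k).ne'] at h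

theorem rho_pos [Finite ι] [Nonempty ι] (hF : IsPolymatroid F) : 0 < rho F := by
  obtain ⟨k⟩ := ‹Nonempty ι›
  have : Nonempty {P : Finset ι × Finset ι // P.1 ⊆ P.2 ∧ F P.1 < F P.2} :=
    ⟨⟨(∅, {k}), Finset.empty_subset _, by rw [hF.empty]; exact hF.singleton_pos k⟩⟩
  obtain ⟨P, hP⟩ := exists_eq_ciInf_of_finite
    (f := fun P : {P : Finset ι × Finset ι // P.1 ⊆ P.2 ∧ F P.1 < F P.2} =>
      (F P.1.2 - F P.1.1) / F (P.1.2 \ P.1.1))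
  rw [rho, ← hP]
  refine div_pos (sub_pos.2 P.2.2) (hF.pos _ (Finset.sdiff_nonempty.2 fun h => ?_))
  exact absurd P.2.2 (not_lt.2 (hF.mono _ _ h))

theorem dualNorm_contraction_le [Finite ι] [Nonempty ι] (hF : IsPolymatroid F) (hJ : IsStable F J)
    {p : ℝ≥0∞} (hp : 1 < p) (s : ι → ℝ) :
    dualNorm (contraction F J) p (fun j => s j.1) ≤ dualNorm F p s / rho F := by
  have hq := one_le_conjExp hp
  have hρ := rho_pos hF
  rw [dualNorm_le_iff (contraction_pos hJ) (div_nonneg (dualNorm_nonneg hF.pos s) hρ.le)]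
  intro A hA
  set B := A.map (Function.Embedding.subtype fun j => j ∉ J) with hB
  have hBne : B.Nonempty := hA.map
  have hBJ : (B ∪ J) \ J = B := by
    rw [Finset.union_sdiff_right, Finset.sdiff_eq_self_iff_disjoint, Finset.disjoint_left]
    intro i hi
    obtain ⟨j, -, rfl⟩ := Finset.mem_map.1 hi
    exact j.2
  have hc := contraction_pos hJ A hA
  have h1 := rho_le (F := F) (A := J) (B := B ∪ J) Finset.subset_union_right (sub_pos.1 hc)
  rw [hBJ, le_div_iff₀ (hF.pos B hBne)] at h1
  have h2 := rpow_sum_le_dualNorm_mul (p := p) hF.pos s hBne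
  rw [hB, Finset.sum_map, ← hB] at h2
  refine h2.trans ?_
  rw [div_mul_eq_mul_div, mul_div_assoc]
  refine mul_le_mul_of_nonneg_left ?_ (dualNorm_nonneg hF.pos s)
  rw [le_div_iff₀ hρ]
  have hq0 : 0 ≤ 1 / conjExp p := one_div_nonneg.2 (by linarith)
  -- The natural factor is $\rho^{1/q}$; as $\rho\le1$ it may be replaced by $\rho$.
  have h3 : rho F ≤ rho F ^ (1 / conjExp p) := by
    conv_lhs => rw [← Real.rpow_one (rho F)]
    exact Real.rpow_le_rpow_of_exponent_ge hρ (rho_le_one hF) ((div_le_one (by linarith)).2 hq)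
  calc F B ^ (1 / conjExp p) * rho F ≤ F B ^ (1 / conjExp p) * rho F ^ (1 / conjExp p) := by
        gcongr
        exact Real.rpow_nonneg (hF.nonneg B) _
    _ = (rho F * F B) ^ (1 / conjExp p) := by
        rw [Real.mul_rpow hρ.le (hF.nonneg B), mul_comm]
    _ ≤ contraction F J A ^ (1 / conjExp p) :=
        Real.rpow_le_rpow (mul_nonneg hρ.le (hF.nonneg B)) h1 hq0

end Polymatroid

/-- The power mean inequality between $\ell_1$ and $\ell_q$; it is the source of the constant
$|J|^{1/p}F(J)^{1-1/p}$ in the condition on $\lambda$. -/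
theorem sum_abs_le_mul_dualNorm {ι : Type*} [Finite ι] {G : Finset ι → ℝ} {p : ℝ≥0∞} (hp : 1 < p)
    (hG : ∀ A : Finset ι, A.Nonempty → 0 < G A) (s : ι → ℝ) {J : Finset ι} (hJ : J.Nonempty) :
    ∑ i ∈ J, |s i| ≤
      (J.card : ℝ) ^ (1 / p).toReal * G J ^ (1 - (1 / p).toReal) * dualNorm G p s := by
  have hq := one_le_conjExp hp
  have hq0 : 0 < conjExp p := by linarith
  have h0 : 0 ≤ ∑ i ∈ J, |s i| := Finset.sum_nonneg fun _ _ => abs_nonneg _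
  have hexp : (conjExp p - 1) * (1 / conjExp p) = (1 / p).toReal := by
    have := inv_conjExp hp
    rw [sub_mul, mul_one_div_cancel hq0.ne', one_mul]
    linarith
  calc ∑ i ∈ J, |s i| = ((∑ i ∈ J, |s i|) ^ conjExp p) ^ (1 / conjExp p) := by
        rw [← Real.rpow_mul h0, mul_one_div_cancel hq0.ne', Real.rpow_one]
    _ ≤ ((J.card : ℝ) ^ (conjExp p - 1) * ∑ i ∈ J, |s i| ^ conjExp p) ^ (1 / conjExp p) :=
        Real.rpow_le_rpow (Real.rpow_nonneg h0 _) (Real.rpow_sum_le_const_mul_sum_rpow J s hq)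
          (one_div_nonneg.2 hq0.le)
    _ = (J.card : ℝ) ^ (1 / p).toReal * (∑ i ∈ J, |s i| ^ conjExp p) ^ (1 / conjExp p) := by
        rw [Real.mul_rpow (by positivity) (sum_abs_rpow_nonneg _ _ _),
          ← Real.rpow_mul (by positivity), hexp]
    _ ≤ (J.card : ℝ) ^ (1 / p).toReal * (dualNorm G p s * G J ^ (1 / conjExp p)) := by
        gcongr
        exact rpow_sum_le_dualNorm_mul hG s hJ
    _ = _ := by rw [inv_conjExp hp]; ring

/-! ### The blocks of the Gram matrix -/

theorem dotProduct_eq_restrict {ι : Type*} [Fintype ι] {J : Finset ι} {x : ι → ℝ} (hx : ∀ i, i ∉ J → x i = 0)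
    (a : ι → ℝ) :
    x ⬝ᵥ a = (fun i : {j // j ∈ J} => x i.1) ⬝ᵥ (fun i : {j // j ∈ J} => a i.1) := by
  rw [dotProduct, dotProduct, Finset.sum_coe_sort J (fun i => x i * a i)]
  refine (Finset.sum_subset (Finset.subset_univ J) fun i _ hi => ?_).symm
  rw [hx i hi, zero_mul]

theorem block_mulVec {ι : Type*} [Fintype ι] (Q : Matrix ι ι ℝ) {J : Finset ι} {x : ι → ℝ}
    (hx : ∀ i, i ∉ J → x i = 0) :
    block Q J *ᵥ (fun i => x i.1) = fun i => (Q *ᵥ x) i.1 := by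
  funext i
  change _ = (fun k => Q i.1 k) ⬝ᵥ x
  rw [dotProduct_comm, dotProduct_eq_restrict hx, dotProduct_comm]
  rfl

section Block

variable {ι : Type*} [Fintype ι] [DecidableEq ι]

theorem minEigenvalue_le {A : Matrix ι ι ℝ} {μ : ℝ} (h : μ ∈ spectrum ℝ A) :
    minEigenvalue A ≤ μ :=
  csInf_le A.finite_real_spectrum.bddBelow h

theorem minEigenvalue_mul_dotProduct_le {A : Matrix ι ι ℝ} (hA : A.IsHermitian) (x : ι → ℝ) :
    minEigenvalue A * (x ⬝ᵥ x) ≤ x ⬝ᵥ (A *ᵥ x) := by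
  -- Shifting by the smallest eigenvalue makes the spectrum nonnegative, hence the matrix positive
  -- semidefinite.
  have hH : (A - algebraMap ℝ (Matrix ι ι ℝ) (minEigenvalue A)).IsHermitian := by
    refine hA.sub ?_
    rw [Matrix.algebraMap_eq_diagonal]
    exact Matrix.isHermitian_diagonal _
  have hpsd := hH.posSemidef_iff_eigenvalues_nonneg.2 fun i => by
    have h1 : hH.eigenvalues i ∈
        spectrum ℝ (A - algebraMap ℝ (Matrix ι ι ℝ) (minEigenvalue A)) := by
      rw [hH.spectrum_real_eq_range_eigenvalues]
      exact Set.mem_range_self i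
    have h2 : hH.eigenvalues i + minEigenvalue A ∈ spectrum ℝ A := by
      have := spectrum.add_mem_add_iff (s := minEigenvalue A) |>.2 h1
      rwa [add_sub_cancel] at this
    have h3 := minEigenvalue_le h2
    show (0 : ℝ) ≤ _
    linarith
  have h := hpsd.dotProduct_mulVec_nonneg x
  rw [star_trivial, Matrix.sub_mulVec, dotProduct_sub, Algebra.algebraMap_eq_smul_one,
    Matrix.smul_mulVec, Matrix.one_mulVec, dotProduct_smul, smul_eq_mul] at h
  linarith

theorem isUnit_det_of_minEigenvalue_pos {A : Matrix ι ι ℝ} (h : 0 < minEigenvalue A) :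
    IsUnit A.det := by
  rw [← Matrix.isUnit_iff_isUnit_det, ← spectrum.zero_notMem_iff ℝ]
  exact fun h0 => absurd (minEigenvalue_le h0) (not_le.2 h)

end Block

theorem gram_transpose {n d : ℕ} (X : Matrix (Fin n) (Fin d) ℝ) : (gram X)ᵀ = gram X := by
  rw [gram, Matrix.transpose_smul, Matrix.transpose_mul, Matrix.transpose_transpose]

theorem gram_mulVec {n d : ℕ} (X : Matrix (Fin n) (Fin d) ℝ) (v : Fin d → ℝ) :
    gram X *ᵥ v = (1 / (n : ℝ)) • (Xᵀ *ᵥ (X *ᵥ v)) := by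
  rw [gram, Matrix.smul_mulVec, Matrix.mulVec_mulVec]

theorem isHermitian_block_gram {n d : ℕ} (X : Matrix (Fin n) (Fin d) ℝ) (J : Finset (Fin d)) :
    (block (gram X) J).IsHermitian :=
  (posSemidef_gram X).isHermitian.submatrix _

theorem minEigenvalue_block_mul_le {n d : ℕ} (X : Matrix (Fin n) (Fin d) ℝ) {J : Finset (Fin d)}
    {x : Fin d → ℝ} (hx : ∀ i, i ∉ J → x i = 0) :
    minEigenvalue (block (gram X) J) * (x ⬝ᵥ x) ≤ x ⬝ᵥ (gram X *ᵥ x) := by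
  rw [dotProduct_eq_restrict hx x, dotProduct_eq_restrict hx (gram X *ᵥ x), ← block_mulVec _ hx]
  exact minEigenvalue_mul_dotProduct_le (isHermitian_block_gram X J) _

theorem eq_zero_of_mulVec_eq_zero {n d : ℕ} {X : Matrix (Fin n) (Fin d) ℝ} {J : Finset (Fin d)}
    (hκ : 0 < minEigenvalue (block (gram X) J)) (v : Fin d → ℝ) (hv : ∀ i, i ∉ J → v i = 0)
    (h : X *ᵥ v = 0) : v = 0 := by
  have h1 := minEigenvalue_block_mul_le X hv
  rw [dotProduct_gram_mulVec, h, dotProduct_zero, mul_zero] at h1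
  have h2 : 0 ≤ v ⬝ᵥ v := Finset.sum_nonneg fun i _ => mul_self_nonneg _
  exact dotProduct_self_eq_zero.1 (le_antisymm (nonpos_of_mul_nonpos_right h1 hκ) h2)


/-! ### Deterministic analysis of the primal-dual witness -/

section Deterministic

variable {n d : ℕ} {p : ℝ≥0∞} {F : Finset (Fin d) → ℝ} {X : Matrix (Fin n) (Fin d) ℝ}
  {J : Finset (Fin d)} {lam : ℝ} {y : Fin n → ℝ} {w s : Fin d → ℝ}

/-- The excess cost over a point with an optimality certificate. -/
theorem IsStationary.cost_eq (hn : 0 < n) (hp : 1 < p) (hF : IsPolymatroid F)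
    (h : IsStationary F (conjExp p) X (n * lam) Finset.univ y w s) (w' : Fin d → ℝ) :
    cost F p X y lam w' = cost F p X y lam w +
      1 / (2 * (n : ℝ)) * ((X *ᵥ (w' - w)) ⬝ᵥ (X *ᵥ (w' - w))) +
      lam * (primalNorm F p w' - w' ⬝ᵥ s) := by
  have hn0 : (n : ℝ) ≠ 0 := by positivity
  have hΩ := primalNorm_eq_of_forall_le hp hF.empty.ge hF.pos h.mem h.le
  have hsq : ∀ v : Fin d → ℝ, ∑ i, (y i - (X *ᵥ v) i) ^ 2 = (y - X *ᵥ v) ⬝ᵥ (y - X *ᵥ v) :=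
    fun v => Finset.sum_congr rfl fun i _ => by rw [Pi.sub_apply, pow_two]
  have hg : (X *ᵥ (w' - w)) ⬝ᵥ (y - X *ᵥ w) = n * lam * (w' ⬝ᵥ s - w ⬝ᵥ s) := by
    have : Xᵀ *ᵥ (y - X *ᵥ w) = (n * lam) • s := funext fun i => h.grad i (Finset.mem_univ i)
    rw [mulVec_dotProduct_eq, this, dotProduct_smul, smul_eq_mul, sub_dotProduct]
  have he : y - X *ᵥ w' = (y - X *ᵥ w) - X *ᵥ (w' - w) := by
    rw [Matrix.mulVec_sub]; abel
  rw [cost, cost, hsq, hsq, hΩ, he, sub_dotProduct, dotProduct_sub (y - X *ᵥ w),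
    dotProduct_sub (X *ᵥ (w' - w)), dotProduct_comm (y - X *ᵥ w) (X *ᵥ (w' - w)), hg]
  field_simp
  ring

/-- A stationary point of the problem restricted to `J` with a strictly feasible certificate
outside of `J` is the unique minimizer of the full problem. -/
theorem IsStationary.isMinOn_iff (hn : 0 < n) (hlam : 0 < lam) (hp : 1 < p)
    (hF : IsPolymatroid F) (hJ : IsStable F J)
    (hX : ∀ v : Fin d → ℝ, (∀ i, i ∉ J → v i = 0) → X *ᵥ v = 0 → v = 0)
    (h : IsStationary F (conjExp p) X (n * lam) J y w s)
    (hlt : dualNorm (contraction F J) p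
      (fun j => (Xᵀ *ᵥ (y - X *ᵥ w)) j.1 / (n * lam)) < 1) (w' : Fin d → ℝ) :
    IsMinOn (cost F p X y lam) Set.univ w' ↔ w' = w := by
  have hnl : (n : ℝ) * lam ≠ 0 := by positivity
  -- The global certificate: it agrees with `s` on $J$ and satisfies the gradient equation
  -- everywhere.
  set t : Fin d → ℝ := fun j => (Xᵀ *ᵥ (y - X *ᵥ w)) j / (n * lam) with ht
  have hts : ∀ i ∈ J, t i = s i := fun i hi => by
    rw [ht]; simp only; rw [h.grad i hi, mul_div_cancel_left₀ _ hnl]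
  have htmem := mem_dualBall_of_contraction hF hJ hp h.mem hts hlt.le
  have hT : IsStationary F (conjExp p) X (n * lam) Finset.univ y w t := by
    refine ⟨fun i hi => absurd (Finset.mem_univ i) hi, htmem, fun u hu => ?_, fun i _ => ?_⟩
    · rw [dotProduct_congr_of_eq_zero h.eq_zero hts]
      exact h.le u hu
    · rw [ht]; simp only; rw [mul_div_cancel₀ _ hnl]
  have hcost := hT.cost_eq hn hp hF
  have hsq : ∀ v : Fin n → ℝ, 0 ≤ 1 / (2 * (n : ℝ)) * (v ⬝ᵥ v) := fun v =>
    mul_nonneg (by positivity) (Finset.sum_nonneg fun i _ => mul_self_nonneg _)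
  have hgap : ∀ v, 0 ≤ lam * (primalNorm F p v - v ⬝ᵥ t) := fun v =>
    mul_nonneg hlam.le (sub_nonneg.2 (dotProduct_le_primalNorm hp hF.empty.ge hF.pos v htmem))
  constructor
  · intro hmin
    have hle : cost F p X y lam w' ≤ cost F p X y lam w := hmin (Set.mem_univ w)
    have h1 := hcost w'
    have h2 := hsq (X *ᵥ (w' - w))
    have h3 := hgap w'
    have h4 : X *ᵥ (w' - w) = 0 := by
      have h5 : 1 / (2 * (n : ℝ)) * ((X *ᵥ (w' - w)) ⬝ᵥ (X *ᵥ (w' - w))) = 0 := by linarith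
      exact dotProduct_self_eq_zero.1
        ((mul_eq_zero.1 h5).resolve_left (by positivity))
    have h6 : primalNorm F p w' = w' ⬝ᵥ t := by
      have h7 : lam * (primalNorm F p w' - w' ⬝ᵥ t) = 0 := by linarith
      exact sub_eq_zero.1 ((mul_eq_zero.1 h7).resolve_left hlam.ne')
    have hsupp : ∀ j, j ∉ J → w' j = 0 := by
      intro j hj
      by_contra hne
      have hC := contraction_pos hJ
      set v : Fin d → ℝ := Pi.single j (SignType.sign (w' j) : ℝ) with hv
      set D := dualNorm (contraction F J) p (fun j => t j.1) with hD
      set E := dualNorm (contraction F J) p (fun j => v j.1) with hE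
      have hE0 : 0 ≤ E := dualNorm_nonneg hC _
      -- Strict slack outside $J$ allows a push of `t` in coordinate $j$ along the sign of $w'_j$,
      -- contradicting its optimality for $w'$. The $+1$ keeps the denominator positive.
      set δ := (1 - D) / (E + 1) with hδ
      have hδ0 : 0 < δ := div_pos (sub_pos.2 hlt) (by linarith)
      have hδE : δ * E ≤ 1 - D := by
        have : δ * (E + 1) = 1 - D := div_mul_cancel₀ _ (by linarith)
        nlinarith
      have hmem : t + δ • v ∈ dualBall F (conjExp p) := by
        refine mem_dualBall_of_contraction hF hJ hp h.mem (fun i hi => ?_) ?_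
        · rw [Pi.add_apply, Pi.smul_apply, hv, Pi.single_eq_of_ne (ne_of_mem_of_not_mem hi hj),
            smul_zero, add_zero, hts i hi]
        · have h8 := dualNorm_add_le hp hC (fun j => t j.1) (δ • fun j => v j.1)
          rw [dualNorm_smul hp, abs_of_pos hδ0] at h8
          exact h8.trans (by linarith)
      have h9 := dotProduct_le_primalNorm hp hF.empty.ge hF.pos w' hmem
      rw [h6, dotProduct_add, dotProduct_smul, hv, dotProduct_single, self_mul_sign,
        smul_eq_mul] at h9
      have := mul_pos hδ0 (abs_pos.2 hne)
      linarith
    exact sub_eq_zero.1 (hX _ (fun i hi => by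
      rw [Pi.sub_apply, hsupp i hi, h.eq_zero i hi, sub_zero]) h4)
  · rintro rfl
    intro v _
    have h1 := hcost v
    have h2 := hsq (X *ᵥ (v - w'))
    have h3 := hgap v
    show cost F p X y lam w' ≤ cost F p X y lam v
    linarith

variable {wstar : Fin d → ℝ} {r : Fin d → ℝ} {c : ℝ}

theorem IsStationary.gram_mulVec_eq
    (hr : ∀ i, r i = 1 / (n : ℝ) * (Xᵀ *ᵥ (y - X *ᵥ wstar)) i) (i : Fin d) :
    1 / (n : ℝ) * (Xᵀ *ᵥ (y - X *ᵥ w)) i = r i - (gram X *ᵥ (w - wstar)) i := by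
  have e : y - X *ᵥ w = (y - X *ᵥ wstar) - X *ᵥ (w - wstar) := by
    rw [Matrix.mulVec_sub]; abel
  rw [e, Matrix.mulVec_sub, Pi.sub_apply, hr, gram_mulVec, Pi.smul_apply, smul_eq_mul, mul_sub]

theorem dualNorm_sub_smul_le (hp : 1 < p) (hF : IsPolymatroid F) (hlam : 0 < lam)
    (hs : s ∈ dualBall F (conjExp p)) (hrc : dualNorm F p r ≤ c) :
    dualNorm F p (r - lam • s) ≤ c + lam := by
  have h1 := dualNorm_add_le hp hF.pos r ((-lam) • s)
  rw [dualNorm_smul hp, abs_neg, abs_of_pos hlam, neg_smul, ← sub_eq_add_neg] at h1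
  have h2 := mul_le_mul_of_nonneg_left
    ((dualNorm_le_one_iff hp hF.empty.ge hF.pos s).2 hs) hlam.le
  linarith

/-- On $J$ the error satisfies $Q\Delta=v$ with $v=r-\lambda s$ and $\Omega^*(v)<2\lambda$. Hence
$\kappa\|\Delta\|_\infty^2\le\Delta^\top Q\Delta\le\|\Delta\|_\infty\|v_J\|_1$, and the condition on
$\lambda$ gives $\|v_J\|_1<\kappa\nu$. -/
theorem IsStationary.abs_sub_lt (hn : 0 < n) (hlam : 0 < lam) (hp : 1 < p)
    (hF : IsPolymatroid F) (hJne : J.Nonempty) (hκ : 0 < minEigenvalue (block (gram X) J))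
    (hwJ : ∀ i, i ∉ J → wstar i = 0)
    (h : IsStationary F (conjExp p) X (n * lam) J y w s)
    (hr : ∀ i, r i = 1 / (n : ℝ) * (Xᵀ *ᵥ (y - X *ᵥ wstar)) i) (hrc : dualNorm F p r ≤ c)
    (hc : c < lam) {ν : ℝ}
    (hle : lam ≤ minEigenvalue (block (gram X) J) * ν /
      (2 * (J.card : ℝ) ^ (1 / p).toReal * F J ^ (1 - (1 / p).toReal))) (i : Fin d) :
    |w i - wstar i| < ν := by
  set κ := minEigenvalue (block (gram X) J) with hκdef
  set C := (J.card : ℝ) ^ (1 / p).toReal * F J ^ (1 - (1 / p).toReal) with hC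
  have hC0 : 0 < C := mul_pos
    (Real.rpow_pos_of_pos (Nat.cast_pos.2 (Finset.card_pos.2 hJne)) _)
    (Real.rpow_pos_of_pos (hF.pos J hJne) _)
  rw [mul_assoc, ← hC, le_div_iff₀ (by positivity)] at hle
  set Δ := w - wstar with hΔ
  set v := r - lam • s with hv
  have hΔJ : ∀ i, i ∉ J → Δ i = 0 := fun i hi => by
    rw [hΔ, Pi.sub_apply, h.eq_zero i hi, hwJ i hi, sub_zero]
  have hQ : ∀ i ∈ J, (gram X *ᵥ Δ) i = v i := fun i hi => by
    have h1 := IsStationary.gram_mulVec_eq (w := w) hr i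
    rw [h.grad i hi] at h1
    have hn0 : (n : ℝ) ≠ 0 := by positivity
    rw [hv, Pi.sub_apply, Pi.smul_apply, smul_eq_mul]
    have h2 : 1 / (n : ℝ) * (n * lam * s i) = lam * s i := by field_simp
    rw [h2] at h1
    linarith
  have hvsum : ∑ i ∈ J, |v i| < κ * ν := by
    have h1 := sum_abs_le_mul_dualNorm hp hF.pos v hJne
    have h2 := dualNorm_sub_smul_le hp hF hlam h.mem hrc
    rw [← hC] at h1
    have h3 : C * dualNorm F p v < C * (2 * lam) :=
      mul_lt_mul_of_pos_left (by linarith) hC0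
    linarith
  have hν : 0 < ν := by
    have h0 : 0 < κ * ν := lt_of_le_of_lt (Finset.sum_nonneg fun _ _ => abs_nonneg _) hvsum
    exact (mul_pos_iff_of_pos_left hκ).1 h0
  obtain ⟨k, -, hk⟩ := Finset.exists_max_image Finset.univ (fun i => |Δ i|) ⟨i, Finset.mem_univ i⟩
  refine lt_of_le_of_lt (hk i (Finset.mem_univ i)) ?_
  rcases (abs_nonneg (Δ k)).eq_or_lt with h0 | h0
  · simpa only [← h0] using hν
  · have h1 := minEigenvalue_block_mul_le X hΔJ
    rw [dotProduct_congr_of_eq_zero hΔJ hQ] at h1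
    have h2 : |Δ k| * |Δ k| ≤ Δ ⬝ᵥ Δ := by
      rw [abs_mul_abs_self]
      exact Finset.single_le_sum (f := fun i => Δ i * Δ i) (fun i _ => mul_self_nonneg _)
        (Finset.mem_univ k)
    have h3 : Δ ⬝ᵥ v ≤ |Δ k| * ∑ i ∈ J, |v i| := by
      rw [Finset.mul_sum, dotProduct,
        ← Finset.sum_subset (Finset.subset_univ J) fun i _ hi => by rw [hΔJ i hi, zero_mul]]
      refine Finset.sum_le_sum fun i _ => ?_
      calc Δ i * v i ≤ |Δ i| * |v i| := by rw [← abs_mul]; exact le_abs_self _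
        _ ≤ |Δ k| * |v i| :=
          mul_le_mul_of_nonneg_right (hk i (Finset.mem_univ i)) (abs_nonneg _)
    have h4 : |Δ k| * (κ * |Δ k|) ≤ |Δ k| * ∑ i ∈ J, |v i| := by
      have := mul_le_mul_of_nonneg_left h2 hκ.le
      linarith
    have h5 := (le_of_mul_le_mul_left h4 h0).trans_lt hvsum
    exact lt_of_mul_lt_mul_left h5 hκ.le

/-- For $j\notin J$ the rescaled gradient is $\lambda^{-1}(r_j-(Q\Delta)_j)$, and $(Q\Delta)_j$ is
the pairing of $Q_{JJ}^{-1}Q_{Jj}$ with $(r-\lambda s)_J$. Duality and irrepresentability bound its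
norm by $\eta/2+(1+\eta/2)(1-\eta)=1-\eta^2/2$. -/
theorem IsStationary.dualNorm_contraction_lt [Nonempty (Fin d)] (hn : 0 < n) (hlam : 0 < lam)
    (hp : 1 < p) (hF : IsPolymatroid F) (hJ : IsStable F J)
    (hκ : 0 < minEigenvalue (block (gram X) J))
    (hwJ : ∀ i, i ∉ J → wstar i = 0)
    (h : IsStationary F (conjExp p) X (n * lam) J y w s)
    (hr : ∀ i, r i = 1 / (n : ℝ) * (Xᵀ *ᵥ (y - X *ᵥ wstar)) i)
    {eta : ℝ} (heta : 0 < eta)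
    (hrc : dualNorm F p r ≤ lam * (eta * rho F / 2))
    (hirr : dualNorm (contraction F J) p
      (fun j => primalNorm (restriction F J) p
        ((block (gram X) J)⁻¹ *ᵥ colBlock (gram X) J j.1)) ≤ 1 - eta) :
    dualNorm (contraction F J) p (fun j => (Xᵀ *ᵥ (y - X *ᵥ w)) j.1 / (n * lam)) < 1 := by
  have hn0 : (n : ℝ) ≠ 0 := by positivity
  have hρ := rho_pos hF
  have hρ1 := rho_le_one hF
  have hC := contraction_pos hJ
  have heta1 : eta ≤ 1 := by
    have := dualNorm_nonneg (p := p) hC (fun j => primalNorm (restriction F J) p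
        ((block (gram X) J)⁻¹ *ᵥ colBlock (gram X) J j.1))
    linarith
  set a := eta * rho F / 2 with ha
  have ha0 : 0 < a := by positivity
  set B := block (gram X) J with hB
  set π : {j // j ∉ J} → ℝ := fun j => primalNorm (restriction F J) p
        (B⁻¹ *ᵥ colBlock (gram X) J j.1) with hπ
  set Δ := w - wstar with hΔ
  set v := r - lam • s with hv
  have hΔJ : ∀ i, i ∉ J → Δ i = 0 := fun i hi => by
    rw [hΔ, Pi.sub_apply, h.eq_zero i hi, hwJ i hi, sub_zero]
  have hgrad := IsStationary.gram_mulVec_eq (w := w) hr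
  have hQ : B *ᵥ (fun i => Δ i.1) = fun i => v i.1 := by
    rw [hB, block_mulVec _ hΔJ]
    funext i
    have h1 := hgrad i.1
    have h2 : 1 / (n : ℝ) * (n * lam * s i) = lam * s i := by field_simp
    rw [h.grad i i.2, h2] at h1
    rw [hv, Pi.sub_apply, Pi.smul_apply, smul_eq_mul]
    linarith
  have hdet : IsUnit B.det := isUnit_det_of_minEigenvalue_pos hκ
  have hBt : Bᵀ = B := by
    rw [← Matrix.conjTranspose_eq_transpose_of_trivial]
    exact isHermitian_block_gram X J
  have hcol : ∀ j, (gram X *ᵥ Δ) j = (B⁻¹ *ᵥ colBlock (gram X) J j) ⬝ᵥ (fun i => v i.1) := by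
    intro j
    have h1 : (fun i : {i // i ∈ J} => Δ i.1) = B⁻¹ *ᵥ fun i => v i.1 := by
      rw [← hQ, Matrix.mulVec_mulVec, Matrix.nonsing_inv_mul _ hdet, Matrix.one_mulVec]
    have h2 : (gram X *ᵥ Δ) j = Δ ⬝ᵥ fun i => gram X i j := by
      rw [← gram_transpose, Matrix.mulVec_transpose, gram_transpose]
      rfl
    rw [h2, dotProduct_eq_restrict hΔJ, h1, dotProduct_comm, mulVec_dotProduct_eq,
      Matrix.transpose_nonsing_inv, hBt]
    rfl
  have hvle : dualNorm (restriction F J) p (fun i => v i.1) ≤ lam * (1 + a) := by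
    have h1 := dualNorm_sub_smul_le hp hF hlam h.mem hrc
    have h2 := dualNorm_restriction_le (J := J) (p := p) hF v
    linarith
  have hr0 : 0 ≤ restriction F J ∅ := by simp [restriction, hF.empty]
  have habs : ∀ j : {j // j ∉ J},
      |(Xᵀ *ᵥ (y - X *ᵥ w)) j.1 / (n * lam)| ≤
        |((fun j : {j // j ∉ J} => |lam⁻¹ * r j.1|) + (1 + a) • π) j| := by
    intro j
    have hπ0 : 0 ≤ π j := primalNorm_nonneg hp hr0 (restriction_pos hF) _
    have h1 : (Xᵀ *ᵥ (y - X *ᵥ w)) j.1 / (n * lam) =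
        lam⁻¹ * r j.1 - lam⁻¹ * (gram X *ᵥ Δ) j.1 := by
      rw [← mul_sub, ← hgrad]
      field_simp
    have h2 : |(gram X *ᵥ Δ) j.1| ≤ lam * (1 + a) * π j := by
      rw [hcol]
      exact abs_dotProduct_le hp hr0 (restriction_pos hF) _ _ (by positivity) hvle
    have h3 : |lam⁻¹ * (gram X *ᵥ Δ) j.1| ≤ (1 + a) * π j := by
      rw [abs_mul, abs_of_pos (inv_pos.2 hlam), inv_mul_le_iff₀ hlam, ← mul_assoc]
      exact h2
    rw [Pi.add_apply, Pi.smul_apply, smul_eq_mul,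
      abs_of_nonneg (add_nonneg (abs_nonneg _) (mul_nonneg (by linarith) hπ0)), h1]
    exact (abs_sub _ _).trans (by gcongr)
  -- The factor $\rho$ in the noise level pays for passing from $\Omega^*$ to the dual norm of the
  -- contraction.
  have hfirst : dualNorm (contraction F J) p (fun j : {j // j ∉ J} => |lam⁻¹ * r j.1|) ≤
      eta / 2 := by
    have h1 : dualNorm (contraction F J) p (fun j : {j // j ∉ J} => |lam⁻¹ * r j.1|) ≤
        dualNorm (contraction F J) p (lam⁻¹ • fun j : {j // j ∉ J} => r j.1) :=
      dualNorm_mono hp hC fun j => (abs_abs _).le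
    rw [dualNorm_smul hp, abs_of_pos (inv_pos.2 hlam)] at h1
    refine h1.trans ((inv_mul_le_iff₀ hlam).2 ?_)
    refine (dualNorm_contraction_le hF hJ hp r).trans ((div_le_iff₀ hρ).2 ?_)
    rw [ha] at hrc
    linarith
  have hadd := dualNorm_add_le hp hC (fun j : {j // j ∉ J} => |lam⁻¹ * r j.1|) ((1 + a) • π)
  rw [dualNorm_smul hp, abs_of_pos (by positivity : 0 < 1 + a)] at hadd
  have hsecond : (1 + a) * dualNorm (contraction F J) p π ≤ (1 + a) * (1 - eta) :=
    mul_le_mul_of_nonneg_left hirr (by positivity)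
  have ha1 : a ≤ eta / 2 := by
    rw [ha]
    have := mul_le_mul_of_nonneg_left hρ1 heta.le
    linarith
  have hlast : (1 + a) * (1 - eta) ≤ (1 + eta / 2) * (1 - eta) :=
    mul_le_mul_of_nonneg_right (by linarith) (by linarith)
  refine lt_of_le_of_lt (dualNorm_mono hp hC habs) ?_
  have : 0 < eta * eta := by positivity
  linarith

end Deterministic

/-! ### Support recovery and its probability -/

theorem minAbs_le {ι : Type*} [Finite ι] {w : ι → ℝ} {j : ι} (hj : w j ≠ 0) : minAbs w ≤ |w j| :=
  ciInf_le (f := fun j : {j // w j ≠ 0} => |w j.1|) (Set.finite_range _).bddBelow ⟨j, hj⟩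


/-- Outside of the flat directions and when the noise is small in dual norm, the support is
recovered by the unique minimizer. -/
theorem exists_unique_minimizer {n d : ℕ} {p : ℝ≥0∞} (hp : 1 < p)
    {F : Finset (Fin d) → ℝ} (hF : IsPolymatroid F)
    {X : Matrix (Fin n) (Fin d) ℝ} {wstar : Fin d → ℝ} (hn : 0 < n)
    {lam eta : ℝ} (hlam : 0 < lam) (heta : 0 < eta)
    {J : Finset (Fin d)} (hJ : IsLeast {A : Finset (Fin d) | IsStable F A ∧ supp wstar ⊆ A} J)
    (hJne : J.Nonempty)
    (hkappa : 0 < minEigenvalue (block (gram X) J))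
    (hirr : dualNorm (contraction F J) p
        (fun j => primalNorm (restriction F J) p
          ((block (gram X) J)⁻¹ *ᵥ colBlock (gram X) J j.1)) ≤ 1 - eta)
    (hle : lam ≤ minEigenvalue (block (gram X) J) * minAbs wstar /
        (2 * (J.card : ℝ) ^ (1 / p).toReal * F J ^ (1 - (1 / p).toReal)))
    {y : Fin n → ℝ}
    (hr : dualNorm F p ((1 / (n : ℝ)) • (Xᵀ *ᵥ (y - X *ᵥ wstar))) ≤ lam * (eta * rho F / 2))
    (hflat : ∀ A j, A ⊆ J → j ∈ J → j ∉ A → ∀ w s,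
      IsStationary F (conjExp p) X (n * lam) A y w s → (Xᵀ *ᵥ (y - X *ᵥ w)) j ≠ 0) :
    ∃ what : Fin d → ℝ, supp what = J ∧
      ∀ w : Fin d → ℝ, IsMinOn (cost F p X y lam) Set.univ w ↔ w = what := by
  have hq := one_le_conjExp hp
  have hX := fun v => eq_zero_of_mulVec_eq_zero (v := v) hkappa
  have : Nonempty (Fin d) := ⟨hJne.choose⟩
  have hwJ : ∀ i, i ∉ J → wstar i = 0 := fun i hi => by
    by_contra h
    exact hi (hJ.1.2 (Finset.mem_filter.2 ⟨Finset.mem_univ _, h⟩))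
  have hnl : 0 < (n : ℝ) * lam := by positivity
  obtain ⟨w, s, h⟩ := exists_isStationary hF.nonneg hq hnl hX y
  have hlt := h.dualNorm_contraction_lt hn hlam hp hF hJ.1.1 hkappa hwJ (fun _ => rfl) heta hr hirr
  refine ⟨w, ?_, h.isMinOn_iff hn hlam hp hF hJ.1.1 hX hlt⟩
  have heta1 : eta ≤ 1 := by
    have := dualNorm_nonneg (p := p) (contraction_pos hJ.1.1)
      (fun j => primalNorm (restriction F J) p
        ((block (gram X) J)⁻¹ *ᵥ colBlock (gram X) J j.1))
    linarith
  have hc : lam * (eta * rho F / 2) < lam := by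
    have := mul_le_mul heta1 (rho_le_one hF) (rho_pos hF).le zero_le_one
    exact mul_lt_of_lt_one_right hlam (by linarith)
  have habs := h.abs_sub_lt hn hlam hp hF hJne hkappa hwJ (fun _ => rfl) hr hc hle
  have hsub : supp wstar ⊆ supp w := fun i hi => by
    have hi' : wstar i ≠ 0 := (Finset.mem_filter.1 hi).2
    refine Finset.mem_filter.2 ⟨Finset.mem_univ _, fun h0 => ?_⟩
    have h1 := habs i
    rw [h0, zero_sub, abs_neg] at h1
    exact absurd (minAbs_le hi') (not_le.2 h1)
  have hsupJ : supp w ⊆ J := fun i hi => by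
    by_contra hiJ
    exact (Finset.mem_filter.1 hi).2 (h.eq_zero i hiJ)
  by_contra hne
  obtain ⟨j, hjJ, hjw, hj⟩ := exists_flat_of_ssubset hF hJ hsub hsupJ hne
  -- The same pair solves the problem restricted to its own support, one of finitely many sets
  -- independent of the noise.
  have hst : IsStationary F (conjExp p) X (n * lam) (supp w) y w s :=
    h.mono hsupJ fun i hi => by
      by_contra h0
      exact hi (Finset.mem_filter.2 ⟨Finset.mem_univ _, h0⟩)
  refine hflat _ j hsupJ hjJ hjw w s hst ?_
  rw [h.grad j hjJ, eq_zero_of_flat hF (by linarith) h.mem h.le hjw hj, mul_zero]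

end SubmodularNorm

theorem mainTheorem10 {n d : ℕ} (p : ℝ≥0∞) (hp : 1 < p)
    (F : Finset (Fin d) → ℝ) (hF : IsPolymatroid F)
    (X : Matrix (Fin n) (Fin d) ℝ) (wstar : Fin d → ℝ) (hw : wstar ≠ 0)
    (sigma lam eta : ℝ) (hsigma : 0 < sigma) (hlam : 0 < lam) (heta : 0 < eta)
    (J : Finset (Fin d)) (hJ : IsLeast {A : Finset (Fin d) | IsStable F A ∧ supp wstar ⊆ A} J)
    (hkappa : 0 < minEigenvalue (block (gram X) J))
    (hirr : dualNorm (contraction F J) p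
        (fun j => primalNorm (restriction F J) p
          ((block (gram X) J)⁻¹ *ᵥ colBlock (gram X) J j.1)) ≤ 1 - eta)
    (hle : lam ≤ minEigenvalue (block (gram X) J) * minAbs wstar /
        (2 * (J.card : ℝ) ^ (1 / p).toReal * F J ^ (1 - (1 / p).toReal)))
    {Ω₁ : Type*} [MeasurableSpace Ω₁] (P₁ : Measure Ω₁) [IsProbabilityMeasure P₁]
    (eps : Ω₁ → EuclideanSpace ℝ (Fin n))
    (heps : HasLaw eps (stdGaussian (EuclideanSpace ℝ (Fin n))) P₁)
    {Ω₂ : Type*} [MeasurableSpace Ω₂] (P₂ : Measure Ω₂) [IsProbabilityMeasure P₂]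
    (z : Ω₂ → EuclideanSpace ℝ (Fin d))
    (hz : HasLaw z (multivariateGaussian 0 (gram X)) P₂) :
    ∃ E : Set Ω₁, MeasurableSet E ∧
      1 - 3 * P₂.real {ω | lam * eta * rho F * √(n : ℝ) / (2 * sigma) <
          dualNorm F p (fun j => z ω j)} ≤ P₁.real E ∧
      ∀ ω ∈ E, ∃ what : Fin d → ℝ, supp what = J ∧
        ∀ w : Fin d → ℝ,
          IsMinOn (cost F p X (fun i => (X *ᵥ wstar) i + sigma * eps ω i) lam) Set.univ w ↔
            w = what := by
  have hX := fun v => eq_zero_of_mulVec_eq_zero (v := v) hkappa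
  obtain ⟨i₀, hi₀⟩ := Function.ne_iff.1 hw
  have hi₀J : i₀ ∈ J := hJ.1.2 (Finset.mem_filter.2 ⟨Finset.mem_univ _, hi₀⟩)
  -- With no observations $X$ would kill a basis vector supported in $J$.
  have hn : 0 < n := by
    rcases Nat.eq_zero_or_pos n with rfl | h
    · have h0 := hX (Pi.single i₀ 1)
        (fun i hi => Pi.single_eq_of_ne (ne_of_mem_of_not_mem hi₀J hi).symm 1)
        (Subsingleton.elim _ _)
      simpa using congrFun h0 i₀
    · exact h
  have hnl : 0 < (n : ℝ) * lam := by positivity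
  have hN : ∀ (A : Finset (Fin d)) (j : Fin d), ∃ N : Set (EuclideanSpace ℝ (Fin n)),
      MeasurableSet N ∧ stdGaussian (EuclideanSpace ℝ (Fin n)) N = 0 ∧
      (A ⊆ J → j ∈ J → j ∉ A → ∀ e w s, IsStationary F (conjExp p) X (n * lam) A
        (X *ᵥ wstar + sigma • (e : EuclideanSpace ℝ (Fin n)).ofLp) w s →
        (Xᵀ *ᵥ (X *ᵥ wstar + sigma • e.ofLp - X *ᵥ w)) j = 0 → e ∈ N) := by
    intro A j
    by_cases h : A ⊆ J ∧ j ∈ J ∧ j ∉ A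
    · obtain ⟨N, h1, h2, h3⟩ := stdGaussian_flat_null hF.nonneg (one_le_conjExp hp) hnl hsigma h.2.2
        (fun v hv => hX v fun i hi => hv i fun h' =>
          hi (Finset.insert_subset h.2.1 h.1 h')) (X *ᵥ wstar)
      exact ⟨N, h1, h2, fun _ _ _ => h3⟩
    · exact ⟨∅, MeasurableSet.empty, measure_empty, fun h1 h2 h3 => absurd ⟨h1, h2, h3⟩ h⟩
  choose N hNm hN0 hN using hN
  set a := lam * eta * rho F * √(n : ℝ) / (2 * sigma) with ha
  have hscore := hasLaw_score X heps
  have hmeas : Measurable fun x : EuclideanSpace ℝ (Fin d) => dualNorm F p (fun j => x j) :=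
    measurable_dualNorm.comp (PiLp.continuous_ofLp 2 _).measurable
  have hTm : MeasurableSet {x : EuclideanSpace ℝ (Fin d) | a < dualNorm F p (fun j => x j)} :=
    measurableSet_lt measurable_const hmeas
  set score : EuclideanSpace ℝ (Fin n) → Fin d → ℝ :=
    fun e => (1 / √(n : ℝ)) • (Xᵀ *ᵥ e.ofLp) with hsc
  have hscm : Measurable score := by
    have : Continuous score := by fun_prop
    exact this.measurable
  set M := ⋃ A, ⋃ j, N A j with hM
  have hMm : MeasurableSet M := MeasurableSet.iUnion fun A => MeasurableSet.iUnion fun j => hNm A j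
  have hM0 : stdGaussian (EuclideanSpace ℝ (Fin n)) M = 0 :=
    measure_iUnion_null fun A => measure_iUnion_null fun j => hN0 A j
  set G : Set (EuclideanSpace ℝ (Fin n)) := {e | dualNorm F p (score e) ≤ a} \ M with hG
  have hGm : MeasurableSet G :=
    (measurableSet_le (measurable_dualNorm.comp hscm) measurable_const).diff hMm
  -- `eps` is only almost everywhere measurable, so the event is replaced by a measurable subset of
  -- full relative measure.
  obtain ⟨E, hEsub, hEm, hEae⟩ :=
    (heps.aemeasurable.nullMeasurable hGm).exists_measurable_subset_ae_eq
  refine ⟨E, hEm, ?_, fun ω hω => ?_⟩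
  · rw [measureReal_congr hEae]
    have h1 : P₂.real {ω | a < dualNorm F p (fun j => z ω j)} =
        P₁.real {ω | a < dualNorm F p (score (eps ω))} :=
      (hz.measureReal_eq hTm).trans (hscore.measureReal_eq hTm).symm
    have h2 : P₁.real {ω | eps ω ∈ M} = 0 := by
      rw [heps.measureReal_eq (p := fun e => e ∈ M) hMm]
      simp [measureReal_def, hM0]
    have h3 : (Set.univ : Set Ω₁) ⊆
        eps ⁻¹' G ∪ ({ω | a < dualNorm F p (score (eps ω))} ∪ {ω | eps ω ∈ M}) := by
      intro ω _
      by_cases h4 : a < dualNorm F p (score (eps ω))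
      · exact Or.inr (Or.inl h4)
      · by_cases h5 : eps ω ∈ M
        · exact Or.inr (Or.inr h5)
        · exact Or.inl ⟨not_lt.1 h4, h5⟩
    have h6 := (measureReal_mono h3 (measure_ne_top P₁ _)).trans (measureReal_union_le _ _)
    have h7 := measureReal_union_le (μ := P₁)
      {ω | a < dualNorm F p (score (eps ω))} {ω | eps ω ∈ M}
    rw [probReal_univ] at h6
    rw [h1]
    -- The union bound already yields $1-\mathbb P(\cdot)$; nonnegativity weakens it to the factor
    -- $3$.
    have h8 : 0 ≤ P₁.real {ω | a < dualNorm F p (score (eps ω))} := measureReal_nonneg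
    linarith
  · have hωG : eps ω ∈ G := hEsub hω
    have hy : (fun i => (X *ᵥ wstar) i + sigma * eps ω i) =
        X *ᵥ wstar + sigma • (eps ω).ofLp := rfl
    rw [hy]
    have hs0 : 0 < √(n : ℝ) := Real.sqrt_pos.2 (Nat.cast_pos.2 hn)
    refine exists_unique_minimizer hp hF hn hlam heta hJ ⟨i₀, hi₀J⟩ hkappa hirr hle ?_
      fun A j h1 h2 h3 w s h4 h5 => hωG.2 (Set.mem_iUnion.2 ⟨A, Set.mem_iUnion.2
        ⟨j, hN A j h1 h2 h3 _ w s h4 h5⟩⟩)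
    have hr : (1 / (n : ℝ)) • (Xᵀ *ᵥ (X *ᵥ wstar + sigma • (eps ω).ofLp - X *ᵥ wstar)) =
        (sigma / √(n : ℝ)) • score (eps ω) := by
      rw [add_sub_cancel_left, Matrix.mulVec_smul, hsc, smul_smul, smul_smul, div_mul_div_comm,
        Real.mul_self_sqrt n.cast_nonneg]
      congr 1
      ring
    rw [hr, dualNorm_smul hp, abs_of_pos (div_pos hsigma hs0)]
    calc sigma / √(n : ℝ) * dualNorm F p (score (eps ω)) ≤ sigma / √(n : ℝ) * a :=
          mul_le_mul_of_nonneg_left hωG.1 (div_pos hsigma hs0).le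
      _ = lam * (eta * rho F / 2) := by rw [ha]; field_simp
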